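/- Let $(\Omega,\mathcal A,\mathbb P)$ be a probability space with $(\Omega,\mathcal A)$ a standard Borel space, equipped with a measurable flow $(\theta_x)_{x\in\mathbb R^d}$ (so $(\omega,x)\mapsto\theta_x\omega$ is measurable, $\theta_0=\mathrm{id}$, $\theta_x\circ\theta_y=\theta_{x+y}$) under which $\mathbb P$ is invariant. Let $\Phi$ be a random measure on $\mathbb R^d$ (a measurable family of locally finite measures $\Phi(\omega,\cdot)$) that is invariant, $\Phi(\omega,B+x)=\Phi(\theta_x\omega,B)$, and locally square-integrable, $\mathbb E\,\Phi(B)^2<\infty$ for all bounded Borel $B$. Let $K$ be a probability kernel from $\Omega\times\mathbb R^d$ to $\mathbb R^d$ that is invariant, $K(\omega,x,B+x)=K(\theta_x\omega,0,B)$. Put $K_x=K(\omega,x,\cdot)$, $K^*_x(B)=K_x(B+x)$, and $K\Phi=\int K_x\,\Phi(dx)$. Let $\gamma=\mathbb E\,\Phi([0,1]^d)$, let $\lambda_d$ be Lebesgue measure, let $$\alpha_\Phi(B)=\mathbb E\iint \mathbf 1\{x\in[0,1]^d,\ y-x\in B\}\,\Phi(dx)\,\Phi(dy)$$ be the reduced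 second moment measure, and let $\beta_\Phi=\alpha_\Phi-\gamma^2\lambda_d$ be the covariance measure, a signed measure on the bounded Borel sets. Let $\mathbb P^\Phi_0(A)=\gamma^{-1}\,\mathbb E\int \mathbf 1\{x\in[0,1]^d,\ \theta_x\in A\}\,\Phi(dx)$ be the Palm probability measure, and let $y\mapsto\mathbb P^\Phi_{0,y}$ be (any version of) the family of two-point Palm probability measures, that is, a probability kernel from $\mathbb R^d$ to $\Omega$ with $$\mathbb E\iint \mathbf 1\{x\in[0,1]^d\}\,f(y-x,\theta_x)\,\Phi(dx)\,\Phi(dy)=\iint f(y,\omega)\,\mathbb P^\Phi_{0,y}(d\omega)\,\alpha_\Phi(dy)$$ for all measurable $f\ge 0$. (If $\gamma=0$, then $\Phi=0$ almost surely and $\mathbb P^\Phi_0$ is taken to be the zero measure.) Define $$\kappa(y)=\Big\|\mathbb E^\Phi_{0,y}\big[K^*_y\otimes K^*_0\big]-\big(\mathbb E^\Phi_0[K^*_0]\big)^{\otimes 2}\Big\|,\qquad y\in\mathbb R^d,$$ where $\|\nu\|=\sup|\int f\,d\nu|$ over all measurable $f$ with values in $[-1,1]$, and assume $$\int\kappa(y)\,\alpha_\Phi(dy)<\infty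 .$$ Let $W\subset\mathbb R^d$ be any bounded convex Borel set with $0$ in its interior. A locally square-integrable random measure $\Psi$ is called hyperuniform with respect to $W$ if $\lim_{r\to\infty}\lambda_d(rW)^{-1}\mathbb V[\Psi(rW)]=0$. Call $W$ Fourier smooth if for some $c,\vartheta>0$ one has $|\int_W e^{-i\langle k,x\rangle}\,dx|\le c(1+\|k\|)^{-(d+\vartheta)/2}$ for all $k\in\mathbb R^d$. Then $K\Phi$ is locally square-integrable, and the following hold. (i) If $\Phi$ is hyperuniform with respect to $W$, then so is $K\Phi$. (ii) If $W$ is Fourier smooth or $|\beta_\Phi|(\mathbb R^d)<\infty$, then $$\lim_{r\to\infty}\lambda_d(rW)^{-1}\,\mathbb V[\Phi(rW)]=\lim_{r\to\infty}\lambda_d(rW)^{-1}\,\mathbb V[K\Phi(rW)],$$ in the sense that if one of the limits exists in $[0,\infty]$, then so does the other and they are equal. If $|\beta_\Phi|(\mathbb R^d)<\infty$, then both limits exist and are finite. -/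

import Mathlib

open MeasureTheory ProbabilityTheory Filter Topology
open scoped ENNReal Pointwise

noncomputable section

namespace InvariantTransport

/-- The Euclidean space `ℝ^d`. -/
abbrev E (d : ℕ) : Type := EuclideanSpace ℝ (Fin d)

/-- The unit cube `[0,1]^d`. -/
def unitCube (d : ℕ) : Set (E d) := {x | ∀ i, x i ∈ Set.Icc (0 : ℝ) 1}

section RandomMeasures

variable {d : ℕ} {Ω : Type*} [MeasurableSpace Ω]

/-- Local square-integrability: `𝔼 Ψ(B)² < ∞` for every bounded Borel set `B`. -/
def LocallySquareIntegrable (P : Measure Ω) (Ψ : Ω → Measure (E d)) : Prop :=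
  ∀ B : Set (E d), MeasurableSet B → Bornology.IsBounded B →
    ∫⁻ ω, (Ψ ω B) ^ 2 ∂P < ∞

/-- The normalized variance `λ_d(rW)⁻¹ 𝕍[Ψ(rW)]`. -/
def normalizedVariance (P : Measure Ω) (Ψ : Ω → Measure (E d)) (W : Set (E d)) (r : ℝ) : ℝ :=
  (volume (r • W)).toReal⁻¹ * variance (fun ω => (Ψ ω (r • W)).toReal) P

/-- Hyperuniformity of `Ψ` with respect to `W`: `Ψ` is locally square-integrable and
`λ_d(rW)⁻¹ 𝕍[Ψ(rW)] → 0` as `r → ∞`. -/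
def Hyperuniform (P : Measure Ω) (Ψ : Ω → Measure (E d)) (W : Set (E d)) : Prop :=
  LocallySquareIntegrable P Ψ ∧ Tendsto (normalizedVariance P Ψ W) atTop (𝓝 0)

/-- `λ_d(rW)⁻¹ 𝕍[Ψ(rW)] → σ` as `r → ∞`, where the value `σ = ∞` is allowed. -/
def HasAsymptoticVariance (P : Measure Ω) (Ψ : Ω → Measure (E d)) (W : Set (E d))
    (σ : ℝ≥0∞) : Prop :=
  Tendsto (fun r => ENNReal.ofReal (normalizedVariance P Ψ W r)) atTop (𝓝 σ)

/-- The intensity `γ = 𝔼 Φ([0,1]^d)`. -/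
def intensity (P : Measure Ω) (Φ : Kernel Ω (E d)) : ℝ≥0∞ :=
  ∫⁻ ω, Φ ω (unitCube d) ∂P

/-- The reduced second moment measure
`α_Φ(B) = 𝔼 ∫ 1{x ∈ [0,1]^d, y - x ∈ B} Φ²(d(x,y))`. -/
def reducedSecondMoment (P : Measure Ω) (Φ : Kernel Ω (E d)) : Measure (E d) :=
  P.bind fun ω =>
    (((Φ ω).restrict (unitCube d)).prod (Φ ω)).map fun p => p.2 - p.1

end RandomMeasures

section TotalVariation

/-- The total variation norm `‖μ - ν‖ = sup |∫ f dμ - ∫ f dν|` of the difference of two finite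
measures, the supremum being over all measurable `f` with values in `[-1,1]`. -/
def tvNormSub {X : Type*} [MeasurableSpace X] (μ ν : Measure X) : ℝ≥0∞ :=
  ⨆ (f : X → ℝ) (_ : Measurable f) (_ : ∀ x, f x ∈ Set.Icc (-1 : ℝ) 1),
    ENNReal.ofReal |∫ x, f x ∂μ - ∫ x, f x ∂ν|

/-- The total variation `|β_Φ|(ℝ^d)` of the covariance measure `β_Φ = α_Φ - γ² λ_d`. This is a
signed measure on the bounded Borel sets; its total variation is the supremum (equivalently, the
limit) of the total variations of its restrictions to the balls of radius `n` around `0`. -/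
def covarianceTotalVariation {d : ℕ} {Ω : Type*} [MeasurableSpace Ω]
    (P : Measure Ω) (Φ : Kernel Ω (E d)) : ℝ≥0∞ :=
  ⨆ n : ℕ, tvNormSub
    ((reducedSecondMoment P Φ).restrict (Metric.ball 0 n))
    (((intensity P Φ) ^ 2 • (volume : Measure (E d))).restrict (Metric.ball 0 n))

end TotalVariation

section Windows

variable {d : ℕ}

/-- The class `𝒦₀` of (Borel) bounded convex sets containing `0` in their interior. -/
structure IsWindow (W : Set (E d)) : Prop where
  convex : Convex ℝ W
  isBounded : Bornology.IsBounded W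
  zero_mem_interior : (0 : E d) ∈ interior W
  measurableSet : MeasurableSet W

/-- Fourier smoothness: the Fourier transform `k ↦ ∫_B exp(-i⟨k,x⟩) dx` of the indicator function
of `B` is bounded in modulus by `c (1 + ‖k‖)^{-(d+ϑ)/2}` for some `c, ϑ > 0`. -/
def FourierSmooth (B : Set (E d)) : Prop :=
  ∃ c ϑ : ℝ, 0 < c ∧ 0 < ϑ ∧ ∀ k : E d,
    ‖∫ x in B, Complex.exp (-(Complex.I * ((inner ℝ k x : ℝ) : ℂ)))‖
      ≤ c * (1 + ‖k‖) ^ (-((d : ℝ) + ϑ) / 2)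

end Windows

section Flow

variable {d : ℕ} {Ω : Type*} [MeasurableSpace Ω]

/-- The relative displacement kernel `K*(ω, x, B) = K(ω, x, B + x)`. -/
def relKernel (K : Kernel (Ω × E d) (E d)) (ω : Ω) (x : E d) : Measure (E d) :=
  (K (ω, x)).map fun z => z - x

/-- The destination `KΦ(ω, ·) = ∫ K(ω, x, ·) Φ(ω, dx)`. -/
def destination (K : Kernel (Ω × E d) (E d)) (Φ : Kernel Ω (E d)) (ω : Ω) : Measure (E d) :=
  (Φ ω).bind fun x => K (ω, x)

variable [AddAction (E d) Ω]

/-- Invariance of a random measure under the flow `θ_x ω = x +ᵥ ω`: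
`Φ(ω, B + x) = Φ(θ_x ω, B)`. -/
def InvariantMeasure (Φ : Kernel Ω (E d)) : Prop :=
  ∀ (ω : Ω) (x : E d) (B : Set (E d)), MeasurableSet B →
    Φ ω ((fun b => b + x) '' B) = Φ (x +ᵥ ω) B

/-- Invariance of a kernel under the flow: `K(ω, x, B + x) = K(θ_x ω, 0, B)`. -/
def InvariantKernel (K : Kernel (Ω × E d) (E d)) : Prop :=
  ∀ (ω : Ω) (x : E d) (B : Set (E d)), MeasurableSet B →
    K (ω, x) ((fun b => b + x) '' B) = K (x +ᵥ ω, 0) B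

/-- The Palm probability measure
`ℙ^Φ_0(A) = γ⁻¹ ∬ 1{x ∈ [0,1]^d, θ_x ω ∈ A} Φ(ω, dx) ℙ(dω)`. -/
def palm (P : Measure Ω) (Φ : Kernel Ω (E d)) : Measure Ω :=
  (intensity P Φ)⁻¹ •
    P.bind fun ω => ((Φ ω).restrict (unitCube d)).map fun x => x +ᵥ ω

/-- The measure
`A ↦ 𝔼 ∫ 1{x ∈ [0,1]^d, (y - x, θ_x) ∈ A} Φ²(d(x,y))` on `ℝ^d × Ω`, with first marginal `α_Φ`. -/
def twoPointCampbell (P : Measure Ω) (Φ : Kernel Ω (E d)) : Measure (E d × Ω) :=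
  P.bind fun ω =>
    (((Φ ω).restrict (unitCube d)).prod (Φ ω)).map fun p => (p.2 - p.1, p.1 +ᵥ ω)

/-- `Q` is a version of the family `y ↦ ℙ^Φ_{0,y}` of two-point Palm probability measures: a
probability kernel from `ℝ^d` to `Ω` which disintegrates the two-point Campbell measure with
respect to `α_Φ`. Such a kernel is unique up to `α_Φ`-null sets. -/
structure IsTwoPointPalm (P : Measure Ω) (Φ : Kernel Ω (E d)) (Q : Kernel (E d) Ω) : Prop where
  isMarkovKernel : IsMarkovKernel Q
  lintegral_eq : ∀ f : E d × Ω → ℝ≥0∞, Measurable f →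
    ∫⁻ p, f p ∂(twoPointCampbell P Φ) = ∫⁻ y, ∫⁻ ω, f (y, ω) ∂(Q y) ∂(reducedSecondMoment P Φ)

/-- The mean relative displacement `𝔼^Φ_0[K*_0]`. -/
def meanRelKernel (P : Measure Ω) (Φ : Kernel Ω (E d)) (K : Kernel (Ω × E d) (E d)) :
    Measure (E d) :=
  (palm P Φ).bind fun ω => relKernel K ω 0

/-- The mixing coefficient `κ(y) = ‖𝔼^Φ_{0,y}[K*_y ⊗ K*_0] - (𝔼^Φ_0[K*_0])^{⊗2}‖`, where
`ℙ^Φ_{0,y} = Q y`. -/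
def mixingCoeff (P : Measure Ω) (Φ : Kernel Ω (E d)) (K : Kernel (Ω × E d) (E d))
    (Q : Kernel (E d) Ω) (y : E d) : ℝ≥0∞ :=
  tvNormSub ((Q y).bind fun ω => (relKernel K ω y).prod (relKernel K ω 0))
    ((meanRelKernel P Φ K).prod (meanRelKernel P Φ K))

end Flow

end InvariantTransport

namespace InvariantTransport
section Existence
variable {d : ℕ} {Ω : Type*} [MeasurableSpace Ω]

theorem measurableSet_unitCube (d : ℕ) : MeasurableSet (unitCube d) := by
  have : unitCube d = ⋂ i, (fun x : E d => x i) ⁻¹' Set.Icc (0 : ℝ) 1 := by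
    ext x; simp [unitCube]
  rw [this]
  exact MeasurableSet.iInter fun i => (by fun_prop : Measurable fun x : E d => x i) measurableSet_Icc

theorem norm_le_of_mem_unitCube {x : E d} (hx : x ∈ unitCube d) : ‖x‖ ≤ d := by
  have h1 : ‖x‖ ^ 2 ≤ d := by
    rw [EuclideanSpace.real_norm_sq_eq]
    calc ∑ i, x i ^ 2 ≤ ∑ _i : Fin d, (1 : ℝ) := by
          refine Finset.sum_le_sum fun i _ => ?_
          have := hx i
          nlinarith [this.1, this.2]
      _ = d := by simp
  rcases Nat.eq_zero_or_pos d with rfl | hd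
  · have : ‖x‖ ^ 2 ≤ 0 := by simpa using h1
    have : ‖x‖ = 0 := by nlinarith [norm_nonneg x]
    simp [this]
  · have : (1 : ℝ) ≤ d := by exact_mod_cast hd
    nlinarith [norm_nonneg x]

/-- A locally finite kernel is s-finite. -/
theorem isSFiniteKernel_of_locallyFinite (Φ : Kernel Ω (E d))
    (h : ∀ ω, IsLocallyFiniteMeasure (Φ ω)) : IsSFiniteKernel Φ := by
  classical
  let A : ℕ → Set (E d) := disjointed fun n => Metric.ball 0 n
  have hA : ∀ n, MeasurableSet (A n) := fun n =>
    MeasurableSet.disjointed (fun n => Metric.isOpen_ball.measurableSet) n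
  have hAfin : ∀ n ω, Φ ω (A n) < ∞ := fun n ω =>
    lt_of_le_of_lt (measure_mono (disjointed_le _ n)) Metric.isBounded_ball.measure_lt_top
  let S : ℕ × ℕ → Set Ω := fun p => {ω | ⌊(Φ ω (A p.1)).toReal⌋₊ = p.2}
  have hS : ∀ p, MeasurableSet (S p) := by
    intro p
    have : Measurable fun ω => ⌊(Φ ω (A p.1)).toReal⌋₊ :=
      Nat.measurable_floor.comp (Φ.measurable_coe (hA p.1)).ennreal_toReal
    exact this (measurableSet_singleton p.2)
  let F : ℕ × ℕ → Kernel Ω (E d) := fun p =>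
    Kernel.piecewise (hS p) (Φ.restrict (hA p.1)) 0
  have hF : ∀ p, IsFiniteKernel (F p) := by
    intro p
    refine ⟨⟨(p.2 + 1 : ℕ), by simp, fun ω => ?_⟩⟩
    by_cases hω : ω ∈ S p
    · simp only [F, Kernel.piecewise_apply, hω, if_true, Kernel.restrict_apply,
        Measure.restrict_apply_univ]
      have h1 := Nat.lt_floor_add_one (Φ ω (A p.1)).toReal
      have h2 : ⌊(Φ ω (A p.1)).toReal⌋₊ = p.2 := hω
      rw [h2] at h1
      rw [← ENNReal.ofReal_toReal (hAfin p.1 ω).ne]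
      calc ENNReal.ofReal (Φ ω (A p.1)).toReal ≤ ENNReal.ofReal ((p.2 + 1 : ℕ) : ℝ) :=
            ENNReal.ofReal_le_ofReal (by push_cast; exact h1.le)
        _ = _ := ENNReal.ofReal_natCast _
    · simp [F, Kernel.piecewise_apply, hω]
  have hsum : Φ = Kernel.sum F := by
    ext ω s hs
    rw [Kernel.sum_apply' _ _ hs, ENNReal.tsum_prod' (f := fun p => F p ω s)]
    have hin : ∀ n, ∑' k, F (n, k) ω s = Φ ω (s ∩ A n) := by
      intro n
      rw [tsum_eq_single ⌊(Φ ω (A n)).toReal⌋₊]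
      · simp [F, S, Kernel.piecewise_apply, Kernel.restrict_apply, Measure.restrict_apply hs]
      · intro k hk
        have : ω ∉ S (n, k) := fun h => hk (Eq.symm h)
        simp [F, Kernel.piecewise_apply, this]
    simp_rw [hin]
    rw [← measure_iUnion]
    · congr 1
      rw [← Set.inter_iUnion, iUnion_disjointed, Metric.iUnion_ball_nat, Set.inter_univ]
    · intro i j hij
      exact ((disjoint_disjointed _ hij).mono Set.inter_subset_right Set.inter_subset_right)
    · exact fun n => hs.inter (hA n)
  rw [hsum]
  exact Kernel.isSFiniteKernel_sum (hκs := fun p => inferInstance)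

variable [AddAction (E d) Ω] [MeasurableVAdd₂ (E d) Ω]

theorem measurable_campbell (Φ : Kernel Ω (E d)) (h : ∀ ω, IsLocallyFiniteMeasure (Φ ω)) :
    Measurable fun ω =>
      (((Φ ω).restrict (unitCube d)).prod (Φ ω)).map fun p : E d × E d => (p.2 - p.1, p.1 +ᵥ ω) := by
  have := isSFiniteKernel_of_locallyFinite Φ h
  let κ : Kernel Ω (E d × Ω) :=
    ((Kernel.id ×ₖ ((Φ.restrict (measurableSet_unitCube d)) ×ₖ Φ))).map
      (fun q : Ω × (E d × E d) => (q.2.2 - q.2.1, q.2.1 +ᵥ q.1))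
  have hm : Measurable (fun q : Ω × (E d × E d) => (q.2.2 - q.2.1, q.2.1 +ᵥ q.1)) := by fun_prop
  convert κ.measurable with ω
  simp only [κ]
  rw [Kernel.map_apply _ hm, Kernel.prod_apply, Kernel.prod_apply, Kernel.id_apply,
    Kernel.restrict_apply, Measure.dirac_prod, Measure.map_map hm (by fun_prop)]
  rfl

theorem reducedSecondMoment_eq (P : Measure Ω) (Φ : Kernel Ω (E d))
    (h : ∀ ω, IsLocallyFiniteMeasure (Φ ω)) :
    reducedSecondMoment P Φ = (twoPointCampbell P Φ).map Prod.fst := by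
  have hm := measurable_campbell Φ h
  have e : ∀ ω, ((((Φ ω).restrict (unitCube d)).prod (Φ ω)).map
      fun p : E d × E d => (p.2 - p.1, p.1 +ᵥ ω)).map Prod.fst =
      (((Φ ω).restrict (unitCube d)).prod (Φ ω)).map fun p : E d × E d => p.2 - p.1 := by
    intro ω
    rw [Measure.map_map measurable_fst (by fun_prop)]; rfl
  have hm2 : Measurable fun ω =>
      (((Φ ω).restrict (unitCube d)).prod (Φ ω)).map fun p : E d × E d => p.2 - p.1 := by
    simp_rw [← e]
    exact (Measure.measurable_map _ measurable_fst).comp hm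
  ext s hs
  rw [reducedSecondMoment, Measure.bind_apply hs hm2.aemeasurable,
    Measure.map_apply measurable_fst hs, twoPointCampbell,
    Measure.bind_apply (measurable_fst hs) hm.aemeasurable]
  refine lintegral_congr fun ω => ?_
  rw [← e, Measure.map_apply measurable_fst hs]

theorem reducedSecondMoment_ball_lt_top (P : Measure Ω) (Φ : Kernel Ω (E d))
    (h : ∀ ω, IsLocallyFiniteMeasure (Φ ω)) (hsq : LocallySquareIntegrable P Φ) (n : ℕ) :
    reducedSecondMoment P Φ (Metric.ball 0 n) < ∞ := by
  rw [reducedSecondMoment_eq P Φ h, Measure.map_apply measurable_fst Metric.isOpen_ball.measurableSet,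
    twoPointCampbell, Measure.bind_apply (measurable_fst Metric.isOpen_ball.measurableSet)
      (measurable_campbell Φ h).aemeasurable]
  refine lt_of_le_of_lt (lintegral_mono fun ω => ?_)
    (hsq (Metric.ball 0 (n + d + 1)) Metric.isOpen_ball.measurableSet Metric.isBounded_ball)
  rw [Measure.map_apply (by fun_prop) (measurable_fst Metric.isOpen_ball.measurableSet), sq]
  rw [← Measure.prod_prod]
  have e : ((Φ ω).restrict (unitCube d)).prod (Φ ω)
      = ((Φ ω).prod (Φ ω)).restrict (unitCube d ×ˢ Set.univ) := by
    rw [← Measure.prod_restrict, Measure.restrict_univ]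
  rw [e, Measure.restrict_apply']
  · refine measure_mono ?_
    rintro ⟨x, y⟩ ⟨hy, hx, -⟩
    have hx' := norm_le_of_mem_unitCube hx
    have hy' : ‖y - x‖ < n := by simpa using hy
    have : ‖y‖ ≤ ‖y - x‖ + ‖x‖ := by simpa using norm_add_le (y - x) x
    have hn : (0 : ℝ) ≤ n := Nat.cast_nonneg n
    simp only [Set.mem_prod, mem_ball_zero_iff]
    constructor <;> linarith
  · exact (measurableSet_unitCube d).prod MeasurableSet.univ

/-- Two-point Palm probability measures exist. -/
theorem exists_isTwoPointPalm [StandardBorelSpace Ω] (P : Measure Ω) [IsProbabilityMeasure P]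
    (Φ : Kernel Ω (E d)) (h : ∀ ω, IsLocallyFiniteMeasure (Φ ω))
    (hsq : LocallySquareIntegrable P Φ) : ∃ Q : Kernel (E d) Ω, IsTwoPointPalm P Φ Q := by
  have : Nonempty Ω := nonempty_of_isProbabilityMeasure P
  set α := reducedSecondMoment P Φ with hα
  have hfst : α = (twoPointCampbell P Φ).map Prod.fst := reducedSecondMoment_eq P Φ h
  have : SigmaFinite α := ⟨⟨⟨fun n => Metric.ball 0 n, fun _ => trivial,
    fun n => reducedSecondMoment_ball_lt_top P Φ h hsq n, Metric.iUnion_ball_nat 0⟩⟩⟩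
  obtain ⟨g, hg0, hgm, hg⟩ := exists_pos_lintegral_lt_of_sigmaFinite α one_ne_zero
  let ρ : Measure (E d × Ω) := (twoPointCampbell P Φ).withDensity fun p => (g p.1 : ℝ≥0∞)
  have hgm' : Measurable fun y => (g y : ℝ≥0∞) := hgm.coe_nnreal_ennreal
  have hρ : IsFiniteMeasure ρ := by
    refine ⟨?_⟩
    simp only [ρ, withDensity_apply _ MeasurableSet.univ, Measure.restrict_univ]
    rw [hfst, lintegral_map hgm' measurable_fst] at hg
    exact hg.trans ENNReal.one_lt_top
  have hρfst : ρ.fst = α.withDensity fun y => (g y : ℝ≥0∞) := by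
    ext s hs
    rw [Measure.fst_apply hs, withDensity_apply _ hs, withDensity_apply _ (measurable_fst hs), hfst,
      setLIntegral_map hs hgm' measurable_fst]
  refine ⟨ρ.condKernel, inferInstance, fun f hf => ?_⟩
  have key : ∀ F : E d × Ω → ℝ≥0∞, Measurable F →
      ∫⁻ p, (g p.1 : ℝ≥0∞) * F p ∂(twoPointCampbell P Φ)
        = ∫⁻ y, (g y : ℝ≥0∞) * ∫⁻ ω, F (y, ω) ∂(ρ.condKernel y) ∂α := by
    intro F hF
    have h1 := Measure.lintegral_condKernel (ρ := ρ) hF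
    rw [hρfst, lintegral_withDensity_eq_lintegral_mul _ hgm' hF.lintegral_kernel_prod_right',
      lintegral_withDensity_eq_lintegral_mul _ (by fun_prop) hF] at h1
    exact h1.symm
  have hne : ∀ y, (g y : ℝ≥0∞) ≠ 0 := fun y => by exact_mod_cast (hg0 y).ne'
  have h2 := key (fun p => (g p.1 : ℝ≥0∞)⁻¹ * f p) (by fun_prop)
  simp_rw [← mul_assoc, ENNReal.mul_inv_cancel (hne _) ENNReal.coe_ne_top, one_mul] at h2
  rw [h2]
  refine lintegral_congr fun y => ?_
  rw [lintegral_const_mul _ (by fun_prop), ← mul_assoc,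
    ENNReal.mul_inv_cancel (hne _) ENNReal.coe_ne_top, one_mul]

end Existence
end InvariantTransport

end

/-!
The Campbell formula of second order (`lintegral_twoPointCampbell`) expresses second moments of a
stationary random measure through the reduced second moment measure `α` and the covariogram
`z ↦ λ_d(B ∩ (B - z))` of the test set: `𝔼 Φ(B)² = ∫ λ_d(B ∩ (B - y)) α(dy)`. Transport by `K` moves
a pair of points at distance vector `y` to distance vector `y + u - v`, where `(u, v)` has the law
`ν_y = 𝔼_{0,y}[K*_y ⊗ K*_0]`, so that `𝔼 KΦ(B)²` is the same integral with the covariogram averaged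
over `ν_y` (`lintegral_destination_sq`), while the mean of `KΦ(B)` is that of `Φ(B)`.

*Decoupling.* Let `μ = 𝔼_0[K*_0]`. Replacing `ν_y` by `μ ⊗ μ` for `B = rW` costs, after division by
`λ_d(rW)`, at most the integral over `α(dy)` of the difference of two averages of the normalized
covariogram. At each `y` this difference tends to `0` since the normalized covariogram lies in
`[0, 1]` and tends to `1`, and it is dominated by the integrable mixing coefficient `κ(y)`
(`tendsto_decouplingError`). This also gives the local square-integrability of `KΦ`. All that
remains is to compare `Φ` with its displacement by independent vectors of law `μ`, whose variance is
`decoupledVariance`.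

*Hyperuniformity.* By the Cauchy–Schwarz inequality, `∫ λ_d(B ∩ (B - y - z)) α(dy) ≤ 𝔼 Φ(B)²` for
every `z`, and so independent displacements do not increase variances (`decoupledVariance_le`).

*Finite covariance measure.* The two normalized variances are the integrals with respect to
`β = α - γ² λ_d` of functions that are bounded by `1` and tend to `1` pointwise. If `|β|` is finite,
both converge to `β(ℝ^d)` by dominated convergence (`exists_tendsto_decoupledVariance`).

*Fourier smooth windows.* Here the normalized covariogram of `rW` is the Fourier transform of the
integrable density `r^d p(r k)`, where `p` decays like a Bessel potential of order `d + ϑ`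
(`exists_spectral_density`), and independent displacements multiply this density by the squared
modulus of the characteristic function of `μ`. The covariance measure `β` is positive definite.
Instead of its spectral measure, which would require Bochner's theorem for unbounded measures, the
nonnegative densities `spectralApprox` are used: the Fourier transforms of `β` cut off by the
normalized covariogram of `NW`. Their integrals against a fixed Bessel potential are bounded
uniformly in `N` (`exists_integral_rpow_mul_spectralApprox_le`), since such a potential is a mixture
of Gaussians and `α` integrates Gaussians. Consequently frequencies away from `0` contribute
`O(r^{-ϑ})` to the variances, near `0` the characteristic function is close to `1`, and letting
`N → ∞` shows that the difference of the two variances is negligible compared with the variance of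
`Φ` (`eventually_decoupledVariance_sub_le`).
-/

noncomputable section

namespace InvariantTransport

/-! ### Campbell formulas -/

section Campbell

theorem volume_unitCube (d : ℕ) : volume (unitCube d) = 1 := by
  have h := EuclideanSpace.volume_preserving_symm_measurableEquiv_toLp (Fin d)
  have e : unitCube d =
      (MeasurableEquiv.toLp 2 (Fin d → ℝ)).symm ⁻¹' Set.Icc (fun _ => (0 : ℝ)) (fun _ => 1) := by
    ext x
    simp [unitCube, Set.mem_Icc, Pi.le_def, forall_and]
  rw [e, h.measure_preimage_equiv, Real.volume_Icc_pi]
  simp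

/-- A measure on `ℝ^d × X` that is invariant under translations of its first component is the
product of Lebesgue measure and its section over the unit cube. Only Tonelli's theorem is needed,
so that finiteness over the unit cube is not required. -/
theorem eq_volume_prod_of_translation_invariant {d : ℕ} {X : Type*} [MeasurableSpace X]
    (ρ : Measure (E d × X)) [SFinite ρ]
    (hρ : ∀ z : E d, ρ.map (fun p => (p.1 - z, p.2)) = ρ) :
    ρ = (volume : Measure (E d)).prod ((ρ.restrict (unitCube d ×ˢ Set.univ)).map Prod.snd) := by
  have hC := measurableSet_unitCube d
  have hCX : MeasurableSet (unitCube d ×ˢ (Set.univ : Set X)) := hC.prod MeasurableSet.univ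
  have hind : Measurable ((unitCube d).indicator (1 : E d → ℝ≥0∞)) :=
    measurable_one.indicator hC
  refine Measure.ext_of_lintegral _ fun h hh => ?_
  have h1 : ∀ x : E d, ∫⁻ z, (unitCube d).indicator (1 : E d → ℝ≥0∞) (x + z) = 1 := by
    intro x
    rw [lintegral_add_left_eq_self (fun z => (unitCube d).indicator (1 : E d → ℝ≥0∞) z) x,
      lintegral_indicator_one hC, volume_unitCube]
  calc ∫⁻ p, h p ∂ρ
      = ∫⁻ p, ∫⁻ z, h p * (unitCube d).indicator (1 : E d → ℝ≥0∞) (p.1 + z) ∂volume ∂ρ := by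
        refine lintegral_congr fun p => ?_
        rw [lintegral_const_mul _ (by fun_prop), h1, mul_one]
    _ = ∫⁻ z, ∫⁻ p, h p * (unitCube d).indicator (1 : E d → ℝ≥0∞) (p.1 + z) ∂ρ ∂volume :=
        lintegral_lintegral_swap (by fun_prop)
    _ = ∫⁻ z, ∫⁻ p, h (p.1 - z, p.2) * (unitCube d).indicator (1 : E d → ℝ≥0∞) p.1 ∂ρ
          ∂volume := by
        refine lintegral_congr fun z => ?_
        conv_lhs => rw [← hρ z]
        rw [lintegral_map (by fun_prop) (by fun_prop)]
        simp
    _ = ∫⁻ p, ∫⁻ z, h (p.1 - z, p.2) * (unitCube d).indicator (1 : E d → ℝ≥0∞) p.1 ∂volume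
          ∂ρ := (lintegral_lintegral_swap (by fun_prop)).symm
    _ = ∫⁻ p, (unitCube d ×ˢ Set.univ).indicator (fun p => ∫⁻ z, h (z, p.2) ∂volume) p ∂ρ := by
        refine lintegral_congr fun p => ?_
        rw [lintegral_mul_const _ (by fun_prop),
          lintegral_sub_left_eq_self (fun z => h (z, p.2)) p.1]
        by_cases hp : p.1 ∈ unitCube d <;> simp [Set.indicator, hp]
    _ = ∫⁻ m, ∫⁻ z, h (z, m) ∂volume ∂((ρ.restrict (unitCube d ×ˢ Set.univ)).map Prod.snd) := by
        rw [lintegral_indicator hCX,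
          lintegral_map (Measurable.lintegral_prod_left' hh) measurable_snd]
    _ = _ := by
        rw [lintegral_prod_symm' _ hh]

/-- Relative displacements at `x` are displacements of the origin after the shift `θ_x`. -/
theorem InvariantKernel.relKernel_eq {d : ℕ} {Ω : Type*} [MeasurableSpace Ω] [AddAction (E d) Ω]
    {K : Kernel (Ω × E d) (E d)} (hK : InvariantKernel K)
    (ω : Ω) (x : E d) : relKernel K ω x = K (x +ᵥ ω, 0) := by
  ext B hB
  rw [← hK ω x B hB, relKernel, Measure.map_apply (by fun_prop) hB]
  congr 1
  ext y
  simp [sub_eq_add_neg]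

variable {d : ℕ} {Ω : Type*} [MeasurableSpace Ω] [AddAction (E d) Ω]

theorem InvariantMeasure.map_sub {Φ : Kernel Ω (E d)} (hΦ : InvariantMeasure Φ) (ω : Ω) (z : E d) :
    Φ (z +ᵥ ω) = (Φ ω).map fun x => x - z := by
  ext B hB
  rw [← hΦ ω z B hB, Measure.map_apply (by fun_prop) hB]
  congr 1
  ext x
  simp [sub_eq_add_neg]

variable [MeasurableVAdd₂ (E d) Ω]

/-- The measure `𝔼 ∫ 1{(x, θ_x) ∈ ·} Φ(dx)` on `ℝ^d × Ω`. -/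
def campbell (P : Measure Ω) (Φ : Kernel Ω (E d)) : Measure (E d × Ω) :=
  (P.bind (Φ ×ₖ Kernel.id)).map fun p => (p.1, p.1 +ᵥ p.2)

/-- The measure `𝔼 ∬ 1{(x, y - x, θ_x) ∈ ·} Φ(dx) Φ(dy)` on `ℝ^d × ℝ^d × Ω`. -/
def campbell₂ (P : Measure Ω) (Φ : Kernel Ω (E d)) : Measure (E d × E d × Ω) :=
  (P.bind (Φ ×ₖ (Φ ×ₖ Kernel.id))).map fun p => (p.1, p.2.1 - p.1, p.1 +ᵥ p.2.2)

variable (P : Measure Ω) (Φ : Kernel Ω (E d)) [IsSFiniteKernel Φ]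

theorem lintegral_campbell {h : E d × Ω → ℝ≥0∞} (hh : Measurable h) :
    ∫⁻ p, h p ∂(campbell P Φ) = ∫⁻ ω, ∫⁻ x, h (x, x +ᵥ ω) ∂(Φ ω) ∂P := by
  rw [campbell, lintegral_map hh (by fun_prop), Measure.lintegral_bind (by fun_prop) (by fun_prop)]
  refine lintegral_congr fun ω => ?_
  rw [Kernel.prod_apply, Kernel.id_apply, lintegral_prod _ (by fun_prop)]
  refine lintegral_congr fun x => ?_
  rw [lintegral_dirac' _ (by fun_prop)]

theorem lintegral_campbell₂ {h : E d × E d × Ω → ℝ≥0∞} (hh : Measurable h) :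
    ∫⁻ p, h p ∂(campbell₂ P Φ)
      = ∫⁻ ω, ∫⁻ x, ∫⁻ y, h (x, y - x, x +ᵥ ω) ∂(Φ ω) ∂(Φ ω) ∂P := by
  rw [campbell₂, lintegral_map hh (by fun_prop), Measure.lintegral_bind (by fun_prop) (by fun_prop)]
  refine lintegral_congr fun ω => ?_
  rw [Kernel.prod_apply, Kernel.prod_apply, Kernel.id_apply, lintegral_prod _ (by fun_prop)]
  refine lintegral_congr fun x => ?_
  rw [lintegral_prod _ (by fun_prop)]
  refine lintegral_congr fun x => ?_
  rw [lintegral_dirac' _ (by fun_prop)]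

instance [SFinite P] : SFinite (campbell P Φ) := by unfold campbell; infer_instance

instance [SFinite P] : SFinite (campbell₂ P Φ) := by unfold campbell₂; infer_instance

variable [VAddInvariantMeasure (E d) Ω P]

variable {Φ} in
theorem campbell_map_sub (hΦ : InvariantMeasure Φ) (z : E d) :
    (campbell P Φ).map (fun p => (p.1 - z, p.2)) = campbell P Φ := by
  refine Measure.ext_of_lintegral _ fun h hh => ?_
  rw [lintegral_map hh (by fun_prop), lintegral_campbell P Φ (by fun_prop),
    lintegral_campbell P Φ hh]
  have hm : Measurable fun ω => ∫⁻ x, h (x, x +ᵥ ω) ∂(Φ ω) :=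
    Measurable.lintegral_kernel_prod_right' (κ := Φ) (f := fun p : Ω × E d => h (p.2, p.2 +ᵥ p.1))
      (by fun_prop)
  rw [← (measurePreserving_vadd z P).lintegral_comp hm]
  refine lintegral_congr fun ω => ?_
  rw [hΦ.map_sub, lintegral_map (by fun_prop) (by fun_prop)]
  simp [vadd_vadd]

variable {Φ} in
theorem campbell₂_map_sub (hΦ : InvariantMeasure Φ) (z : E d) :
    (campbell₂ P Φ).map (fun p => (p.1 - z, p.2)) = campbell₂ P Φ := by
  refine Measure.ext_of_lintegral _ fun h hh => ?_
  rw [lintegral_map hh (by fun_prop), lintegral_campbell₂ P Φ (by fun_prop),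
    lintegral_campbell₂ P Φ hh]
  have hm : Measurable fun ω => ∫⁻ x, ∫⁻ y, h (x, y - x, x +ᵥ ω) ∂(Φ ω) ∂(Φ ω) := by
    refine Measurable.lintegral_kernel_prod_right' (κ := Φ)
      (f := fun p : Ω × E d => ∫⁻ y, h (p.2, y - p.2, p.2 +ᵥ p.1) ∂(Φ p.1)) ?_
    exact Measurable.lintegral_kernel_prod_right' (κ := Φ.comap Prod.fst measurable_fst)
      (f := fun p : (Ω × E d) × E d => h (p.1.2, p.2 - p.1.2, p.1.2 +ᵥ p.1.1)) (by fun_prop)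
  rw [← (measurePreserving_vadd z P).lintegral_comp hm]
  refine lintegral_congr fun ω => ?_
  rw [hΦ.map_sub, lintegral_map (Measurable.lintegral_prod_right' (f := fun p : E d × E d =>
    h (p.1, p.2 - p.1, p.1 +ᵥ z +ᵥ ω)) (by fun_prop)) (by fun_prop)]
  refine lintegral_congr fun x => ?_
  rw [lintegral_map (by fun_prop) (by fun_prop)]
  simp [vadd_vadd]

variable [SFinite P]

variable {Φ} in
/-- Campbell's formula for a stationary random measure. -/
theorem exists_lintegral_palm_eq (hΦ : InvariantMeasure Φ) :
    ∃ ρ : Measure Ω, SFinite ρ ∧ ρ Set.univ = intensity P Φ ∧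
      ∀ h : E d × Ω → ℝ≥0∞, Measurable h →
        ∫⁻ ω, ∫⁻ x, h (x, x +ᵥ ω) ∂(Φ ω) ∂P = ∫⁻ x, ∫⁻ ω, h (x, ω) ∂ρ := by
  have hC : MeasurableSet (unitCube d ×ˢ (Set.univ : Set Ω)) :=
    (measurableSet_unitCube d).prod MeasurableSet.univ
  refine ⟨((campbell P Φ).restrict (unitCube d ×ˢ Set.univ)).map Prod.snd, inferInstance, ?_,
    fun h hh => ?_⟩
  · rw [Measure.map_apply measurable_snd MeasurableSet.univ, Set.preimage_univ,
      Measure.restrict_apply_univ, ← lintegral_indicator_one hC,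
      lintegral_campbell P Φ (measurable_one.indicator hC), intensity]
    refine lintegral_congr fun ω => ?_
    rw [← lintegral_indicator_one (measurableSet_unitCube d)]
    refine lintegral_congr fun x => ?_
    by_cases hx : x ∈ unitCube d <;> simp [hx]
  · rw [← lintegral_campbell P Φ hh, ← lintegral_prod _ hh.aemeasurable,
      ← eq_volume_prod_of_translation_invariant _ (campbell_map_sub P hΦ)]

variable {Φ} in
/-- Campbell's formula of second order for a stationary random measure. -/
theorem lintegral_twoPointCampbell (hΦ : InvariantMeasure Φ)
    (hlf : ∀ ω, IsLocallyFiniteMeasure (Φ ω)) {h : E d × E d × Ω → ℝ≥0∞} (hh : Measurable h) :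
    ∫⁻ ω, ∫⁻ x, ∫⁻ y, h (x, y - x, x +ᵥ ω) ∂(Φ ω) ∂(Φ ω) ∂P
      = ∫⁻ x, ∫⁻ q, h (x, q) ∂(twoPointCampbell P Φ) := by
  have hC : MeasurableSet (unitCube d ×ˢ (Set.univ : Set (E d × Ω))) :=
    (measurableSet_unitCube d).prod MeasurableSet.univ
  have e : ((campbell₂ P Φ).restrict (unitCube d ×ˢ Set.univ)).map Prod.snd
      = twoPointCampbell P Φ := by
    refine Measure.ext_of_lintegral _ fun f hf => ?_
    rw [lintegral_map hf measurable_snd, ← lintegral_indicator hC,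
      lintegral_campbell₂ P Φ
        ((show Measurable fun a : E d × E d × Ω => f a.2 by fun_prop).indicator hC),
      twoPointCampbell,
      Measure.lintegral_bind (measurable_campbell Φ hlf).aemeasurable hf.aemeasurable]
    refine lintegral_congr fun ω => ?_
    rw [lintegral_map hf (by fun_prop), lintegral_prod _ (by fun_prop),
      ← lintegral_indicator (measurableSet_unitCube d)]
    refine lintegral_congr fun x => ?_
    by_cases hx : x ∈ unitCube d <;> simp [hx]
  rw [← lintegral_campbell₂ P Φ hh]
  conv_lhs => rw [eq_volume_prod_of_translation_invariant _ (campbell₂_map_sub P hΦ), e]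
  have : SFinite (twoPointCampbell P Φ) := by rw [← e]; infer_instance
  rw [lintegral_prod _ hh.aemeasurable]

end Campbell

/-! ### Covariograms -/

section Covariogram

variable {d : ℕ}

/-- The covariogram `z ↦ λ_d(B ∩ (B - z))` of a set `B`. -/
def covariogram (B : Set (E d)) (z : E d) : ℝ≥0∞ :=
  volume (B ∩ (fun x => x + z) ⁻¹' B)

variable {B : Set (E d)}

theorem covariogram_eq_lintegral (hB : MeasurableSet B) (z : E d) :
    covariogram B z = ∫⁻ x, B.indicator 1 x * B.indicator 1 (x + z) := by
  rw [covariogram, ← lintegral_indicator_one (hB.inter ((by fun_prop : Measurable _) hB))]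
  refine lintegral_congr fun x => ?_
  by_cases h1 : x ∈ B <;> by_cases h2 : x + z ∈ B <;> simp [h1, h2]

@[fun_prop]
theorem measurable_covariogram (hB : MeasurableSet B) : Measurable (covariogram B) := by
  have hind : Measurable (B.indicator (1 : E d → ℝ≥0∞)) := measurable_one.indicator hB
  rw [funext (covariogram_eq_lintegral hB)]
  exact Measurable.lintegral_prod_right'
    (f := fun p : E d × E d => B.indicator 1 p.2 * B.indicator 1 (p.2 + p.1)) (by fun_prop)

theorem covariogram_le (B : Set (E d)) (z : E d) : covariogram B z ≤ volume B :=
  measure_mono Set.inter_subset_left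

theorem covariogram_zero (B : Set (E d)) : covariogram B 0 = volume B := by
  simp [covariogram]

theorem covariogram_neg (hB : MeasurableSet B) (z : E d) :
    covariogram B (-z) = covariogram B z := by
  have hind : Measurable (B.indicator (1 : E d → ℝ≥0∞)) := measurable_one.indicator hB
  rw [covariogram_eq_lintegral hB, covariogram_eq_lintegral hB,
    ← lintegral_add_right_eq_self _ z]
  simp [mul_comm]

theorem lintegral_covariogram (hB : MeasurableSet B) (z : E d) :
    ∫⁻ y, covariogram B (y + z) = volume B ^ 2 := by
  have hind : Measurable (B.indicator (1 : E d → ℝ≥0∞)) := measurable_one.indicator hB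
  rw [lintegral_add_right_eq_self]
  simp_rw [covariogram_eq_lintegral hB]
  rw [lintegral_lintegral_swap (by fun_prop)]
  calc ∫⁻ x, ∫⁻ y, B.indicator 1 x * B.indicator 1 (x + y)
      = ∫⁻ x, B.indicator 1 x * volume B := by
        refine lintegral_congr fun x => ?_
        rw [lintegral_const_mul _ (by fun_prop),
          lintegral_add_left_eq_self (fun y => B.indicator (1 : E d → ℝ≥0∞) y) x,
          lintegral_indicator_one hB]
    _ = _ := by
        rw [lintegral_mul_const _ hind, lintegral_indicator_one hB, sq]

end Covariogram

/-! ### Second moments of the transported measure -/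

section Moments

variable {d : ℕ} {Ω : Type*} [MeasurableSpace Ω] {K : Kernel (Ω × E d) (E d)}

theorem destination_apply (Φ : Kernel Ω (E d)) (ω : Ω) {B : Set (E d)} (hB : MeasurableSet B) :
    destination K Φ ω B = ∫⁻ x, K (ω, x) B ∂(Φ ω) := by
  rw [destination, Measure.bind_apply hB]
  exact (K.measurable.comp measurable_prodMk_left).aemeasurable

theorem measurable_destination_apply {Φ : Kernel Ω (E d)} [IsSFiniteKernel Φ] {B : Set (E d)}
    (hB : MeasurableSet B) :
    Measurable fun ω => destination K Φ ω B := by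
  simp_rw [destination_apply Φ _ hB]
  exact Measurable.lintegral_kernel_prod_right' (κ := Φ) (f := fun p => K p B)
    (K.measurable_coe hB)

variable [AddAction (E d) Ω]

theorem apply_eq_lintegral_relKernel (hK : InvariantKernel K) (ω : Ω) (x : E d)
    {B : Set (E d)} (hB : MeasurableSet B) :
    K (ω, x) B = ∫⁻ u, B.indicator 1 (x + u) ∂(K (x +ᵥ ω, 0)) := by
  have hind : Measurable (B.indicator (1 : E d → ℝ≥0∞)) := measurable_one.indicator hB
  rw [← hK.relKernel_eq, relKernel, lintegral_map (by fun_prop) (by fun_prop)]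
  simp only [add_sub_cancel]
  rw [lintegral_indicator_one hB]

variable [MeasurableVAdd₂ (E d) Ω] {P : Measure Ω} {Φ : Kernel Ω (E d)}

theorem sigmaFinite_reducedSecondMoment
    (hlf : ∀ ω, IsLocallyFiniteMeasure (Φ ω))
    (hsq : LocallySquareIntegrable P Φ) : SigmaFinite (reducedSecondMoment P Φ) :=
  ⟨⟨⟨fun n => Metric.ball 0 n, fun _ => trivial,
    fun n => reducedSecondMoment_ball_lt_top P Φ hlf hsq n, Metric.iUnion_ball_nat 0⟩⟩⟩

variable [VAddInvariantMeasure (E d) Ω P]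

theorem lintegral_measure_translate_sq (hΦ : InvariantMeasure Φ)
    {B : Set (E d)} (hB : MeasurableSet B) (z : E d) :
    ∫⁻ ω, Φ ω ((fun x => x + z) ⁻¹' B) ^ 2 ∂P = ∫⁻ ω, Φ ω B ^ 2 ∂P := by
  rw [← (measurePreserving_vadd (-z) P).lintegral_comp ((Φ.measurable_coe hB).pow_const 2)]
  refine lintegral_congr fun ω => ?_
  rw [hΦ.map_sub, Measure.map_apply (by fun_prop) hB]
  simp

variable [IsProbabilityMeasure P]

theorem lintegral_lintegral_eq_intensity_mul (hlf : ∀ ω, IsLocallyFiniteMeasure (Φ ω))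
    (hΦ : InvariantMeasure Φ) {f : E d → ℝ≥0∞} (hf : Measurable f) :
    ∫⁻ ω, ∫⁻ x, f x ∂(Φ ω) ∂P = intensity P Φ * ∫⁻ x, f x := by
  have := isSFiniteKernel_of_locallyFinite Φ hlf
  obtain ⟨ρ, -, hρ, h⟩ := exists_lintegral_palm_eq P hΦ
  rw [h (fun p => f p.1) (by fun_prop), ← hρ]
  simp [lintegral_mul_const _ hf, mul_comm]

/-- Mixed second moments of linear statistics in terms of the reduced second moment measure. -/
theorem lintegral_mul_lintegral_eq (hlf : ∀ ω, IsLocallyFiniteMeasure (Φ ω))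
    (hΦ : InvariantMeasure Φ) (hsq : LocallySquareIntegrable P Φ)
    {f g : E d → ℝ≥0∞} (hf : Measurable f) (hg : Measurable g) :
    ∫⁻ ω, (∫⁻ x, f x ∂(Φ ω)) * (∫⁻ x, g x ∂(Φ ω)) ∂P
      = ∫⁻ y, ∫⁻ x, f x * g (x + y) ∂volume ∂(reducedSecondMoment P Φ) := by
  have := isSFiniteKernel_of_locallyFinite Φ hlf
  have := sigmaFinite_reducedSecondMoment hlf hsq
  have h := lintegral_twoPointCampbell P hΦ hlf
    (h := fun p => f p.1 * g (p.1 + p.2.1)) (by fun_prop)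
  simp only [add_sub_cancel] at h
  rw [lintegral_lintegral_swap (by fun_prop)]
  convert h using 1
  · refine lintegral_congr fun ω => ?_
    rw [← lintegral_mul_const _ hf]
    refine lintegral_congr fun x => ?_
    rw [lintegral_const_mul _ hg]
  · refine lintegral_congr fun x => ?_
    rw [reducedSecondMoment_eq P Φ hlf, lintegral_map (by fun_prop) measurable_fst]

/-- The mixed second moment of the masses of `B` and of a translate of `B` is an integral of the
translated covariogram. -/
theorem lintegral_measure_mul_measure_translate (hlf : ∀ ω, IsLocallyFiniteMeasure (Φ ω))
    (hΦ : InvariantMeasure Φ) (hsq : LocallySquareIntegrable P Φ)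
    {B : Set (E d)} (hB : MeasurableSet B) (z : E d) :
    ∫⁻ ω, Φ ω B * Φ ω ((fun x => x + z) ⁻¹' B) ∂P
      = ∫⁻ y, covariogram B (y + z) ∂(reducedSecondMoment P Φ) := by
  have hind : Measurable (B.indicator (1 : E d → ℝ≥0∞)) := measurable_one.indicator hB
  have hBz : MeasurableSet ((fun x => x + z) ⁻¹' B) := (by fun_prop : Measurable _) hB
  have h := lintegral_mul_lintegral_eq hlf hΦ hsq hind
    (g := fun x => B.indicator 1 (x + z)) (by fun_prop)
  simp_rw [covariogram_eq_lintegral hB, ← add_assoc]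
  rw [← h]
  refine lintegral_congr fun ω => ?_
  rw [lintegral_indicator_one hB, ← lintegral_indicator_one hBz]
  rfl

/-- By the Cauchy–Schwarz inequality and stationarity, integrating a translated covariogram against
the reduced second moment measure gives at most the second moment itself. -/
theorem lintegral_covariogram_le (hlf : ∀ ω, IsLocallyFiniteMeasure (Φ ω))
    (hΦ : InvariantMeasure Φ) (hsq : LocallySquareIntegrable P Φ)
    {B : Set (E d)} (hB : MeasurableSet B) (z : E d) :
    ∫⁻ y, covariogram B (y + z) ∂(reducedSecondMoment P Φ) ≤ ∫⁻ ω, Φ ω B ^ 2 ∂P := by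
  have hBz : MeasurableSet ((fun x => x + z) ⁻¹' B) := (by fun_prop : Measurable _) hB
  rw [← lintegral_measure_mul_measure_translate hlf hΦ hsq hB z]
  have h2 : ∫⁻ ω, 2 * (Φ ω B * Φ ω ((fun x => x + z) ⁻¹' B)) ∂P ≤
      ∫⁻ ω, (Φ ω B ^ 2 + Φ ω ((fun x => x + z) ⁻¹' B) ^ 2) ∂P := by
    refine lintegral_mono fun ω => ?_
    rcases eq_or_ne (Φ ω B) ∞ with h | h
    · simp [h]
    rcases eq_or_ne (Φ ω ((fun x => x + z) ⁻¹' B)) ∞ with h' | h'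
    · simp [h']
    rw [← ENNReal.toReal_le_toReal (by finiteness) (by finiteness)]
    rw [ENNReal.toReal_add (by finiteness) (by finiteness)]
    simp only [ENNReal.toReal_mul, ENNReal.toReal_pow, ENNReal.toReal_ofNat]
    nlinarith [sq_nonneg ((Φ ω B).toReal - (Φ ω ((fun x => x + z) ⁻¹' B)).toReal)]
  have hm : Measurable fun ω => Φ ω B * Φ ω ((fun x => x + z) ⁻¹' B) :=
    (Φ.measurable_coe hB).mul (Φ.measurable_coe hBz)
  rw [lintegral_const_mul _ hm,
    lintegral_add_left ((Φ.measurable_coe hB).pow_const 2),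
    lintegral_measure_translate_sq hΦ hB z, ← two_mul] at h2
  exact (ENNReal.mul_le_mul_iff_right (by simp) (by simp)).1 h2

variable [IsMarkovKernel K]

/-- Transport by a probability kernel preserves the mean measure. -/
theorem lintegral_destination (hlf : ∀ ω, IsLocallyFiniteMeasure (Φ ω))
    (hΦ : InvariantMeasure Φ) (hK : InvariantKernel K) {B : Set (E d)} (hB : MeasurableSet B) :
    ∫⁻ ω, destination K Φ ω B ∂P = intensity P Φ * volume B := by
  have := isSFiniteKernel_of_locallyFinite Φ hlf
  have hind : Measurable (B.indicator (1 : E d → ℝ≥0∞)) := measurable_one.indicator hB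
  obtain ⟨ρ, _, hρ, h⟩ := exists_lintegral_palm_eq P hΦ
  simp_rw [destination_apply Φ _ hB, apply_eq_lintegral_relKernel hK _ _ hB]
  have hm : Measurable fun p : E d × Ω => ∫⁻ u, B.indicator (1 : E d → ℝ≥0∞) (p.1 + u)
      ∂(K (p.2, 0)) :=
    Measurable.lintegral_kernel_prod_right' (κ := K.comap (fun p : E d × Ω => (p.2, (0 : E d)))
      (by fun_prop)) (f := fun q : (E d × Ω) × E d => B.indicator 1 (q.1.1 + q.2)) (by fun_prop)
  rw [h (fun p => ∫⁻ u, B.indicator 1 (p.1 + u) ∂(K (p.2, 0))) hm,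
    lintegral_lintegral_swap hm.aemeasurable, ← hρ]
  have e : ∀ ω, ∫⁻ x, ∫⁻ u, B.indicator (1 : E d → ℝ≥0∞) (x + u) ∂(K (ω, 0)) = volume B := by
    intro ω
    rw [lintegral_lintegral_swap (by fun_prop)]
    simp_rw [lintegral_add_right_eq_self (fun x => B.indicator (1 : E d → ℝ≥0∞) x)]
    simp [lintegral_indicator_one hB]
  simp_rw [e]
  simp [mul_comm]

/-- The family `y ↦ 𝔼_{0,y}[K*_y ⊗ K*_0]` of laws of the relative displacements of two points. -/
def displacementPair (K : Kernel (Ω × E d) (E d)) (Q : Kernel (E d) Ω) :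
    Kernel (E d) (E d × E d) :=
  ((K.comap (fun p : E d × Ω => (p.1 +ᵥ p.2, (0 : E d))) (by fun_prop)) ×ₖ
    (K.comap (fun p : E d × Ω => (p.2, (0 : E d))) (by fun_prop))) ∘ₖ (Kernel.id ×ₖ Q)

instance (Q : Kernel (E d) Ω) [IsMarkovKernel Q] : IsMarkovKernel (displacementPair K Q) := by
  unfold displacementPair; infer_instance

theorem lintegral_displacementPair (Q : Kernel (E d) Ω) [IsMarkovKernel Q] (y : E d)
    {f : E d × E d → ℝ≥0∞} (hf : Measurable f) :
    ∫⁻ p, f p ∂(displacementPair K Q y)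
      = ∫⁻ ω, ∫⁻ v, ∫⁻ u, f (u, v) ∂(K (y +ᵥ ω, 0)) ∂(K (ω, 0)) ∂(Q y) := by
  rw [displacementPair, Kernel.lintegral_comp _ _ _ hf, Kernel.prod_apply, Kernel.id_apply,
    Measure.dirac_prod, lintegral_map hf.lintegral_kernel (by fun_prop)]
  refine lintegral_congr fun ω => ?_
  rw [Kernel.prod_apply, Kernel.comap_apply, Kernel.comap_apply,
    lintegral_prod_symm' _ hf]

/-- The kernel `displacementPair` is the family of measures in the definition of `mixingCoeff`. -/
theorem displacementPair_apply (hK : InvariantKernel K) (Q : Kernel (E d) Ω) [IsMarkovKernel Q]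
    (y : E d) :
    (Q y).bind (fun ω => (relKernel K ω y).prod (relKernel K ω 0)) = displacementPair K Q y := by
  refine Measure.ext_of_lintegral _ fun f hf => ?_
  have e : (fun ω => (relKernel K ω y).prod (relKernel K ω 0)) =
      ((K.comap (fun ω : Ω => (y +ᵥ ω, (0 : E d))) (by fun_prop)) ×ₖ
        (K.comap (fun ω : Ω => (ω, (0 : E d))) (by fun_prop))) := by
    ext1 ω
    rw [Kernel.prod_apply, hK.relKernel_eq, hK.relKernel_eq, zero_vadd]
    rfl
  rw [e, Measure.lintegral_bind (by fun_prop) hf.aemeasurable, lintegral_displacementPair Q y hf]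
  refine lintegral_congr fun ω => ?_
  rw [Kernel.prod_apply, Kernel.comap_apply, Kernel.comap_apply, lintegral_prod_symm' _ hf]

/-- The second moment of `KΦ(B)`: a pair of points at distance vector `y` is moved to distance
vector `y + u - v`, where `(u, v)` has the law `𝔼_{0,y}[K*_y ⊗ K*_0]`. -/
theorem lintegral_destination_sq (hlf : ∀ ω, IsLocallyFiniteMeasure (Φ ω))
    (hΦ : InvariantMeasure Φ) (hsq : LocallySquareIntegrable P Φ) (hK : InvariantKernel K)
    {Q : Kernel (E d) Ω} (hQ : IsTwoPointPalm P Φ Q) {B : Set (E d)} (hB : MeasurableSet B) :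
    ∫⁻ ω, destination K Φ ω B ^ 2 ∂P
      = ∫⁻ y, ∫⁻ p, covariogram B (y + (p.1 - p.2)) ∂(displacementPair K Q y)
          ∂(reducedSecondMoment P Φ) := by
  have := isSFiniteKernel_of_locallyFinite Φ hlf
  have := sigmaFinite_reducedSecondMoment hlf hsq
  have := hQ.isMarkovKernel
  have hind : Measurable (B.indicator (1 : E d → ℝ≥0∞)) := measurable_one.indicator hB
  have hm : Measurable fun p : E d × Ω => ∫⁻ u, B.indicator (1 : E d → ℝ≥0∞) (p.1 + u)
      ∂(K (p.2, 0)) :=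
    Measurable.lintegral_kernel_prod_right' (κ := K.comap (fun p : E d × Ω => (p.2, (0 : E d)))
      (by fun_prop)) (f := fun q : (E d × Ω) × E d => B.indicator 1 (q.1.1 + q.2)) (by fun_prop)
  set F : E d × Ω → ℝ≥0∞ := fun p => ∫⁻ u, B.indicator (1 : E d → ℝ≥0∞) (p.1 + u) ∂(K (p.2, 0))
    with hF
  have hmF : Measurable fun p : E d × E d × Ω =>
      F (p.1, p.2.2) * F (p.1 + p.2.1, p.2.1 +ᵥ p.2.2) := by
    fun_prop
  have h := lintegral_twoPointCampbell P hΦ hlf hmF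
  simp only [add_sub_cancel, vadd_vadd, sub_add_cancel] at h
  have hm1 : ∀ ω, Measurable fun x => F (x, x +ᵥ ω) := fun ω => by fun_prop
  calc ∫⁻ ω, destination K Φ ω B ^ 2 ∂P
      = ∫⁻ ω, ∫⁻ x, ∫⁻ y, F (x, x +ᵥ ω) * F (y, y +ᵥ ω) ∂(Φ ω) ∂(Φ ω) ∂P := by
        refine lintegral_congr fun ω => ?_
        rw [destination_apply Φ _ hB, sq]
        simp_rw [apply_eq_lintegral_relKernel hK _ _ hB]
        rw [← lintegral_mul_const _ (hm1 ω)]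
        refine lintegral_congr fun x => ?_
        rw [← lintegral_const_mul _ (hm1 ω)]
    _ = ∫⁻ x, ∫⁻ q, F (x, q.2) * F (x + q.1, q.1 +ᵥ q.2) ∂(twoPointCampbell P Φ) := h
    _ = ∫⁻ x, ∫⁻ y, ∫⁻ ω, F (x, ω) * F (x + y, y +ᵥ ω) ∂(Q y) ∂(reducedSecondMoment P Φ)
          ∂volume := by
        refine lintegral_congr fun x => ?_
        exact hQ.lintegral_eq (fun q => F (x, q.2) * F (x + q.1, q.1 +ᵥ q.2)) (by fun_prop)
    _ = ∫⁻ y, ∫⁻ x, ∫⁻ ω, F (x, ω) * F (x + y, y +ᵥ ω) ∂(Q y) ∂volume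
          ∂(reducedSecondMoment P Φ) := by
        refine lintegral_lintegral_swap (Measurable.aemeasurable ?_)
        exact Measurable.lintegral_kernel_prod_right' (κ := Q.comap Prod.snd measurable_snd)
          (f := fun q : (E d × E d) × Ω => F (q.1.1, q.2) * F (q.1.1 + q.1.2, q.1.2 +ᵥ q.2))
          (by fun_prop)
    _ = _ := by
        refine lintegral_congr fun y => ?_
        rw [lintegral_displacementPair Q y (by fun_prop), lintegral_lintegral_swap (by fun_prop)]
        refine lintegral_congr fun ω => ?_
        calc ∫⁻ x, F (x, ω) * F (x + y, y +ᵥ ω)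
            = ∫⁻ x, ∫⁻ v, ∫⁻ u, B.indicator 1 (x + v) * B.indicator 1 (x + y + u)
                ∂(K (y +ᵥ ω, 0)) ∂(K (ω, 0)) ∂volume := by
              refine lintegral_congr fun x => ?_
              simp only [hF]
              rw [← lintegral_mul_const _ (by fun_prop)]
              refine lintegral_congr fun v => ?_
              rw [← lintegral_const_mul _ (by fun_prop)]
          _ = ∫⁻ v, ∫⁻ x, ∫⁻ u, B.indicator 1 (x + v) * B.indicator 1 (x + y + u)
                ∂(K (y +ᵥ ω, 0)) ∂volume ∂(K (ω, 0)) := by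
              refine lintegral_lintegral_swap (Measurable.aemeasurable ?_)
              exact Measurable.lintegral_prod_right' (f := fun q : (E d × E d) × E d =>
                B.indicator 1 (q.1.1 + q.1.2) * B.indicator 1 (q.1.1 + y + q.2)) (by fun_prop)
          _ = _ := by
              refine lintegral_congr fun v => ?_
              rw [lintegral_lintegral_swap (by fun_prop)]
              refine lintegral_congr fun u => ?_
              rw [covariogram_eq_lintegral hB, eq_comm, ← lintegral_add_right_eq_self _ v]
              refine lintegral_congr fun x => ?_
              dsimp only
              congr 2
              abel

end Moments

/-! ### Normalized covariograms of scaled windows -/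

section WindowCorrelation

variable {d : ℕ} {W : Set (E d)}

theorem IsWindow.volume_ne_top (hW : IsWindow W) : volume W ≠ ∞ :=
  hW.isBounded.measure_lt_top.ne

theorem IsWindow.volume_pos (hW : IsWindow W) : 0 < volume W :=
  (isOpen_interior.measure_pos volume ⟨0, hW.zero_mem_interior⟩).trans_le
    (measure_mono interior_subset)

theorem volume_smul_eq (W : Set (E d)) {r : ℝ} (hr : 0 < r) :
    volume (r • W) = ENNReal.ofReal (r ^ d) * volume W := by
  rw [Measure.addHaar_smul, finrank_euclideanSpace_fin, abs_of_nonneg (by positivity)]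

theorem covariogram_smul {r : ℝ} (hr : 0 < r) (z : E d) :
    covariogram (r • W) z = ENNReal.ofReal (r ^ d) * covariogram W (r⁻¹ • z) := by
  rw [covariogram, covariogram, ← volume_smul_eq _ hr]
  congr 1
  ext x
  simp [Set.mem_smul_set_iff_inv_smul_mem₀ hr.ne', smul_add]

theorem IsWindow.smul (hW : IsWindow W) {r : ℝ} (hr : 0 < r) : IsWindow (r • W) where
  convex := hW.convex.smul r
  isBounded := hW.isBounded.smul₀ r
  zero_mem_interior := by
    rw [interior_smul₀ hr.ne']
    exact ⟨0, hW.zero_mem_interior, smul_zero r⟩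
  measurableSet := hW.measurableSet.const_smul₀ r

theorem isWindow_ball {R : ℝ} (hR : 0 < R) : IsWindow (Metric.ball (0 : E d) R) where
  convex := convex_ball 0 R
  isBounded := Metric.isBounded_ball
  zero_mem_interior := by simp [Metric.isOpen_ball.interior_eq, hR]
  measurableSet := Metric.isOpen_ball.measurableSet

/-- The covariogram is continuous since the boundary of a convex set is a null set. -/
theorem continuous_covariogram (hW : IsWindow W) : Continuous (covariogram W) := by
  have hind : Measurable (W.indicator (1 : E d → ℝ≥0∞)) := measurable_one.indicator hW.measurableSet
  refine continuous_iff_continuousAt.2 fun z₀ => ?_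
  rw [ContinuousAt, funext (covariogram_eq_lintegral hW.measurableSet)]
  refine tendsto_lintegral_filter_of_dominated_convergence (W.indicator 1)
    (Eventually.of_forall fun z => by fun_prop) (Eventually.of_forall fun z => ?_) ?_ ?_
  · refine Eventually.of_forall fun x => mul_le_of_le_one_right' ?_
    exact Set.indicator_le_self' (by simp) _
  · rw [lintegral_indicator_one hW.measurableSet]
    exact hW.volume_ne_top
  · have h0 : volume ((fun x : E d => x + z₀) ⁻¹' frontier W) = 0 := by
      rw [measure_preimage_add_right, hW.convex.addHaar_frontier volume]
    have h1 : ∀ᵐ x : E d, x + z₀ ∉ frontier W := measure_eq_zero_iff_ae_notMem.1 h0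
    filter_upwards [h1] with x hx
    have ht : Tendsto (fun z => x + z) (𝓝 z₀) (𝓝 (x + z₀)) :=
      (continuous_const.add continuous_id).tendsto z₀
    refine tendsto_const_nhds.congr' ?_
    by_cases hxi : x + z₀ ∈ interior W
    · filter_upwards [ht (isOpen_interior.mem_nhds hxi)] with z hz
      rw [Set.indicator_of_mem (interior_subset hxi), Set.indicator_of_mem (interior_subset hz)]
      rfl
    · have hxc : x + z₀ ∉ closure W := fun h => hx ⟨h, hxi⟩
      filter_upwards [ht (isClosed_closure.isOpen_compl.mem_nhds hxc)] with z hz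
      rw [Set.indicator_of_notMem fun h => hxc (subset_closure h),
        Set.indicator_of_notMem fun h => hz (subset_closure h)]

/-- The normalized covariogram `y ↦ λ_d(rW ∩ (rW - y)) / λ_d(rW)` of a scaled window. -/
def windowCorr (W : Set (E d)) (r : ℝ) (y : E d) : ℝ :=
  (covariogram (r • W) y).toReal / (volume (r • W)).toReal

theorem windowCorr_nonneg (W : Set (E d)) (r : ℝ) (y : E d) : 0 ≤ windowCorr W r y := by
  unfold windowCorr; positivity

theorem windowCorr_le_one (hW : IsWindow W) {r : ℝ} (hr : 0 < r) (y : E d) :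
    windowCorr W r y ≤ 1 := by
  refine div_le_one_of_le₀ ?_ ENNReal.toReal_nonneg
  exact ENNReal.toReal_mono (hW.smul hr).volume_ne_top (covariogram_le _ _)

theorem volume_smul_toReal_pos (hW : IsWindow W) {r : ℝ} (hr : 0 < r) :
    0 < (volume (r • W)).toReal :=
  ENNReal.toReal_pos (hW.smul hr).volume_pos.ne' (hW.smul hr).volume_ne_top

theorem ofReal_windowCorr (hW : IsWindow W) {r : ℝ} (hr : 0 < r) (y : E d) :
    volume (r • W) * ENNReal.ofReal (windowCorr W r y) = covariogram (r • W) y := by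
  have h := volume_smul_toReal_pos hW hr
  have hc : covariogram (r • W) y ≠ ∞ :=
    ((covariogram_le _ _).trans_lt (hW.smul hr).volume_ne_top.lt_top).ne
  rw [← ENNReal.ofReal_toReal (hW.smul hr).volume_ne_top, ← ENNReal.ofReal_mul h.le, windowCorr,
    mul_div_cancel₀ _ h.ne', ENNReal.ofReal_toReal hc]

theorem windowCorr_eq (W : Set (E d)) {r : ℝ} (hr : 0 < r) (y : E d) :
    windowCorr W r y = (covariogram W (r⁻¹ • y)).toReal / (volume W).toReal := by
  rw [windowCorr, covariogram_smul hr, volume_smul_eq _ hr, ENNReal.toReal_mul, ENNReal.toReal_mul,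
    mul_div_mul_left]
  rw [ENNReal.toReal_ofReal (by positivity)]
  positivity

theorem continuous_windowCorr (hW : IsWindow W) {r : ℝ} (hr : 0 < r) :
    Continuous (windowCorr W r) := by
  have h : Continuous fun y => (covariogram (r • W) y).toReal :=
    ENNReal.continuousOn_toReal.comp_continuous (continuous_covariogram (hW.smul hr)) fun y =>
      ((covariogram_le _ _).trans_lt (hW.smul hr).volume_ne_top.lt_top).ne
  exact h.div_const _

theorem tendsto_windowCorr (hW : IsWindow W) (y : E d) :
    Tendsto (fun r => windowCorr W r y) atTop (𝓝 1) := by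
  have h1 : Tendsto (fun r : ℝ => r⁻¹ • y) atTop (𝓝 0) := by
    simpa using (tendsto_inv_atTop_zero (𝕜 := ℝ)).smul_const y
  have h2 : Tendsto (fun r : ℝ => windowCorr W 1 (r⁻¹ • y)) atTop (𝓝 (windowCorr W 1 0)) :=
    ((continuous_windowCorr hW one_pos).tendsto 0).comp h1
  have h3 : windowCorr W 1 0 = 1 := by
    rw [windowCorr, covariogram_zero, div_self (volume_smul_toReal_pos hW one_pos).ne']
  rw [h3] at h2
  refine h2.congr' ?_
  filter_upwards [eventually_gt_atTop 0] with r hr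
  rw [windowCorr_eq W hr, windowCorr_eq W one_pos]
  simp

end WindowCorrelation

/-! ### Replacing the displacements by independent ones -/

section Decoupling

variable {d : ℕ} {W : Set (E d)}

theorem ofReal_abs_integral_sub_le_tvNormSub {X : Type*} [MeasurableSpace X] (μ ν : Measure X)
    {f : X → ℝ} (hf : Measurable f) (h : ∀ x, f x ∈ Set.Icc (-1 : ℝ) 1) :
    ENNReal.ofReal |∫ x, f x ∂μ - ∫ x, f x ∂ν| ≤ tvNormSub μ ν :=
  le_iSup₂_of_le f hf (le_iSup_of_le h le_rfl)

/-- The error made at scale `r` when the laws `ν y` of pairs of displacements are replaced by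
the fixed law `π`. -/
def decouplingError (α : Measure (E d)) (ν : Kernel (E d) (E d × E d)) (π : Measure (E d × E d))
    (W : Set (E d)) (r : ℝ) : ℝ≥0∞ :=
  ∫⁻ y, ENNReal.ofReal |∫ p, windowCorr W r (y + (p.1 - p.2)) ∂(ν y)
    - ∫ p, windowCorr W r (y + (p.1 - p.2)) ∂π| ∂α

theorem windowCorr_mem_Icc (hW : IsWindow W) {r : ℝ} (hr : 0 < r) (y : E d) :
    windowCorr W r y ∈ Set.Icc (-1 : ℝ) 1 :=
  ⟨by linarith [windowCorr_nonneg W r y], windowCorr_le_one hW hr y⟩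

variable {α : Measure (E d)} {ν : Kernel (E d) (E d × E d)} {π : Measure (E d × E d)}

theorem decoupling_integrand_le (hW : IsWindow W) {r : ℝ} (hr : 0 < r) (y : E d) :
    ENNReal.ofReal |∫ p, windowCorr W r (y + (p.1 - p.2)) ∂(ν y)
      - ∫ p, windowCorr W r (y + (p.1 - p.2)) ∂π| ≤ tvNormSub (ν y) π := by
  have hc := continuous_windowCorr hW hr
  exact ofReal_abs_integral_sub_le_tvNormSub (ν y) π
    (f := fun p => windowCorr W r (y + (p.1 - p.2))) (hc.comp (by fun_prop)).measurable
    fun p => windowCorr_mem_Icc hW hr _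

theorem decouplingError_lt_top (hW : IsWindow W) (hκ : ∫⁻ y, tvNormSub (ν y) π ∂α < ∞)
    {r : ℝ} (hr : 0 < r) : decouplingError α ν π W r < ∞ :=
  (lintegral_mono fun y => decoupling_integrand_le hW hr y).trans_lt hκ

variable [IsMarkovKernel ν] [IsProbabilityMeasure π]

theorem integrable_windowCorr_comp {X : Type*} [MeasurableSpace X] (μ : Measure X)
    [IsFiniteMeasure μ] (hW : IsWindow W) {r : ℝ} (hr : 0 < r) {g : X → E d} (hg : Measurable g) :
    Integrable (fun x => windowCorr W r (g x)) μ := by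
  refine Integrable.of_bound
    ((continuous_windowCorr hW hr).measurable.comp hg).aestronglyMeasurable 1 ?_
  refine Eventually.of_forall fun x => ?_
  rw [Real.norm_eq_abs, abs_of_nonneg (windowCorr_nonneg _ _ _)]
  exact windowCorr_le_one hW hr _

theorem tendsto_integral_windowCorr {X : Type*} [MeasurableSpace X] (μ : Measure X)
    [IsProbabilityMeasure μ] (hW : IsWindow W) {g : X → E d} (hg : Measurable g) :
    Tendsto (fun r => ∫ x, windowCorr W r (g x) ∂μ) atTop (𝓝 1) := by
  have h : Tendsto (fun r => ∫ x, windowCorr W r (g x) ∂μ) atTop (𝓝 (∫ _, (1 : ℝ) ∂μ)) := by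
    refine tendsto_integral_filter_of_dominated_convergence (fun _ => 1) ?_ ?_
      (integrable_const 1) (Eventually.of_forall fun x => tendsto_windowCorr hW _)
    · filter_upwards [eventually_gt_atTop 0] with r hr
      exact (integrable_windowCorr_comp μ hW hr hg).aestronglyMeasurable
    · filter_upwards [eventually_gt_atTop 0] with r hr
      refine Eventually.of_forall fun x => ?_
      rw [Real.norm_eq_abs, abs_of_nonneg (windowCorr_nonneg _ _ _)]
      exact windowCorr_le_one hW hr _
  simpa using h

theorem measurable_integral_windowCorr_kernel (hW : IsWindow W) {r : ℝ} (hr : 0 < r) :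
    Measurable fun y => ∫ p, windowCorr W r (y + (p.1 - p.2)) ∂(ν y) := by
  have hc := continuous_windowCorr hW hr
  have : StronglyMeasurable fun q : E d × (E d × E d) => windowCorr W r (q.1 + (q.2.1 - q.2.2)) :=
    (hc.comp (by fun_prop)).stronglyMeasurable
  exact this.integral_kernel_prod_right'.measurable

theorem measurable_decoupling_integrand (hW : IsWindow W) {r : ℝ} (hr : 0 < r) :
    Measurable fun y => ENNReal.ofReal |∫ p, windowCorr W r (y + (p.1 - p.2)) ∂(ν y)
      - ∫ p, windowCorr W r (y + (p.1 - p.2)) ∂π| := by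
  have h1 := measurable_integral_windowCorr_kernel (ν := ν) hW hr
  have h2 := measurable_integral_windowCorr_kernel (ν := Kernel.const _ π) hW hr
  simp only [Kernel.const_apply] at h2
  exact (measurable_norm.comp (h1.sub h2)).ennreal_ofReal

/-- If the mixing coefficient is integrable, then replacing the laws `ν y` by `π` is harmless for
large windows: at each `y` both mean correlations tend to `1`, and `tvNormSub (ν y) π` dominates. -/
theorem tendsto_decouplingError (hW : IsWindow W) (hκ : ∫⁻ y, tvNormSub (ν y) π ∂α < ∞) :
    Tendsto (decouplingError α ν π W) atTop (𝓝 0) := by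
  refine tendsto_of_seq_tendsto fun u hu => ?_
  obtain ⟨N, hN⟩ := (hu.eventually_gt_atTop 0).exists_forall_of_atTop
  rw [← tendsto_add_atTop_iff_nat N]
  set F : ℕ → E d → ℝ≥0∞ := fun n y => ENNReal.ofReal
    |∫ p, windowCorr W (u (n + N)) (y + (p.1 - p.2)) ∂(ν y)
      - ∫ p, windowCorr W (u (n + N)) (y + (p.1 - p.2)) ∂π| with hF
  have hpos : ∀ n, 0 < u (n + N) := fun n => hN _ (Nat.le_add_left N n)
  -- The mixing coefficient need not be measurable, but the supremum of the countably many
  -- integrands is a measurable function below it.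
  have h := tendsto_lintegral_of_dominated_convergence (μ := α) (F := F) (f := fun _ => 0)
    (fun y => ⨆ n, F n y) (fun n => measurable_decoupling_integrand hW (hpos n))
    (fun n => Eventually.of_forall fun y => le_iSup (fun n => F n y) n)
    ((lintegral_mono fun y =>
      iSup_le fun n => decoupling_integrand_le hW (hpos n) y).trans_lt hκ).ne
    (Eventually.of_forall fun y => ?_)
  · rw [lintegral_zero] at h
    exact h
  · have hu' : Tendsto (fun n => u (n + N)) atTop atTop := (tendsto_add_atTop_iff_nat N).2 hu
    have h1 := ((tendsto_integral_windowCorr (ν y) hW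
      (g := fun p : E d × E d => y + (p.1 - p.2)) (by fun_prop)).comp hu').sub
      ((tendsto_integral_windowCorr π hW
      (g := fun p : E d × E d => y + (p.1 - p.2)) (by fun_prop)).comp hu')
    have h2 := (ENNReal.continuous_ofReal.comp continuous_abs).tendsto _ |>.comp h1
    simpa [Function.comp_def] using h2

/-- The mean of the normalized covariogram after a shift by the difference of a pair of
displacements of law `π`. -/
def meanWindowCorr (π : Measure (E d × E d)) (W : Set (E d)) (r : ℝ) (y : E d) : ℝ :=
  ∫ p, windowCorr W r (y + (p.1 - p.2)) ∂π

theorem lintegral_covariogram_comp_eq (hW : IsWindow W) {r : ℝ} (hr : 0 < r) (y : E d) :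
    ∫⁻ p, covariogram (r • W) (y + (p.1 - p.2)) ∂π
      = volume (r • W) * ENNReal.ofReal (meanWindowCorr π W r y) := by
  have hc := continuous_windowCorr hW hr
  rw [meanWindowCorr,
    ofReal_integral_eq_lintegral_ofReal (integrable_windowCorr_comp π hW hr (by fun_prop))
    (Eventually.of_forall fun _ => windowCorr_nonneg _ _ _),
    ← lintegral_const_mul _ (show Measurable fun p : E d × E d =>
      ENNReal.ofReal (windowCorr W r (y + (p.1 - p.2))) from
        (hc.measurable.comp (by fun_prop)).ennreal_ofReal)]
  simp_rw [ofReal_windowCorr hW hr]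

/-- Up to `decouplingError`, the second moments computed with `ν` and with `π` agree. -/
theorem lintegral_covariogram_le_add_decouplingError (hW : IsWindow W) {r : ℝ} (hr : 0 < r) :
    ∫⁻ y, ∫⁻ p, covariogram (r • W) (y + (p.1 - p.2)) ∂(ν y) ∂α
        ≤ ∫⁻ y, ∫⁻ p, covariogram (r • W) (y + (p.1 - p.2)) ∂π ∂α
          + volume (r • W) * decouplingError α ν π W r ∧
    ∫⁻ y, ∫⁻ p, covariogram (r • W) (y + (p.1 - p.2)) ∂π ∂α
        ≤ ∫⁻ y, ∫⁻ p, covariogram (r • W) (y + (p.1 - p.2)) ∂(ν y) ∂α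
          + volume (r • W) * decouplingError α ν π W r := by
  have hm := measurable_decoupling_integrand (ν := ν) (π := π) hW hr
  have key : ∀ a b : ℝ, ENNReal.ofReal a ≤ ENNReal.ofReal b + ENNReal.ofReal |a - b| := by
    intro a b
    refine le_trans (ENNReal.ofReal_le_ofReal ?_) ENNReal.ofReal_add_le
    linarith [le_abs_self (a - b)]
  constructor
  · rw [decouplingError, ← lintegral_const_mul _ hm, ← lintegral_add_right _ (hm.const_mul _)]
    refine lintegral_mono fun y => ?_
    rw [lintegral_covariogram_comp_eq hW hr, lintegral_covariogram_comp_eq hW hr, ← mul_add]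
    exact mul_le_mul_right (key _ _) _
  · rw [decouplingError, ← lintegral_const_mul _ hm, ← lintegral_add_right _ (hm.const_mul _)]
    refine lintegral_mono fun y => ?_
    rw [lintegral_covariogram_comp_eq hW hr, lintegral_covariogram_comp_eq hW hr, ← mul_add,
      abs_sub_comm]
    exact mul_le_mul_right (key _ _) _

end Decoupling

/-! ### Variances of the transported measure -/

section Variance

theorem variance_toReal_eq {Ω : Type*} [MeasurableSpace Ω] {P : Measure Ω} [IsProbabilityMeasure P]
    {X : Ω → ℝ≥0∞} (hX : Measurable X) (h2 : ∫⁻ ω, X ω ^ 2 ∂P ≠ ∞) :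
    variance (fun ω => (X ω).toReal) P = (∫⁻ ω, X ω ^ 2 ∂P).toReal - (∫⁻ ω, X ω ∂P).toReal ^ 2 := by
  have hsq : Integrable (fun ω => (X ω ^ 2).toReal) P :=
    integrable_toReal_of_lintegral_ne_top (hX.pow_const 2).aemeasurable h2
  have hfin : ∀ᵐ ω ∂P, X ω ^ 2 < ∞ := ae_lt_top (hX.pow_const 2) h2
  have hfin' : ∀ᵐ ω ∂P, X ω < ∞ := by
    filter_upwards [hfin] with ω h
    by_contra hc
    simp [not_lt_top_iff.1 hc] at h
  have hmem : MemLp (fun ω => (X ω).toReal) 2 P := by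
    rw [memLp_two_iff_integrable_sq hX.ennreal_toReal.aestronglyMeasurable]
    simpa using hsq
  rw [variance_eq_sub hmem, integral_toReal hX.aemeasurable hfin',
    ← integral_toReal (hX.pow_const 2).aemeasurable hfin]
  simp

variable {d : ℕ}

/-- The normalized variance of the mass in `rW` of a stationary random measure with reduced second
moment measure `α` and intensity `γ` after displacing its points by vectors that are independent
of it, pairs of displacements having law `π`. For `π` the Dirac measure at `0` this is the
normalized variance of the random measure itself. -/
def decoupledVariance (α : Measure (E d)) (γ : ℝ) (π : Measure (E d × E d)) (W : Set (E d))
    (r : ℝ) : ℝ :=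
  (volume (r • W)).toReal⁻¹ *
    ((∫⁻ y, ∫⁻ p, covariogram (r • W) (y + (p.1 - p.2)) ∂π ∂α).toReal
      - (γ * (volume (r • W)).toReal) ^ 2)

variable {Ω : Type*} [MeasurableSpace Ω] [AddAction (E d) Ω] [MeasurableVAdd₂ (E d) Ω]
  {P : Measure Ω} [IsProbabilityMeasure P] [VAddInvariantMeasure (E d) Ω P] {Φ : Kernel Ω (E d)}

theorem intensity_ne_top {d : ℕ} {Ω : Type*} [MeasurableSpace Ω] {P : Measure Ω}
    [IsProbabilityMeasure P] {Φ : Kernel Ω (E d)} (hsq : LocallySquareIntegrable P Φ) :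
    intensity P Φ ≠ ∞ := by
  have hb : Bornology.IsBounded (unitCube d) :=
    Metric.isBounded_closedBall.subset fun x hx =>
      mem_closedBall_zero_iff.2 (norm_le_of_mem_unitCube hx)
  have hle : intensity P Φ ≤ ∫⁻ ω, (1 + Φ ω (unitCube d) ^ 2) ∂P := by
    refine lintegral_mono fun ω => ?_
    rcases le_total (Φ ω (unitCube d)) 1 with h | h
    · exact h.trans le_self_add
    · exact (le_self_pow h two_ne_zero).trans le_add_self
  refine (hle.trans_lt ?_).ne
  rw [lintegral_add_left measurable_const]
  simpa using hsq _ (measurableSet_unitCube d) hb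

theorem lintegral_measure_sq_eq (hlf : ∀ ω, IsLocallyFiniteMeasure (Φ ω))
    (hΦ : InvariantMeasure Φ) (hsq : LocallySquareIntegrable P Φ)
    {B : Set (E d)} (hB : MeasurableSet B) :
    ∫⁻ ω, Φ ω B ^ 2 ∂P = ∫⁻ y, covariogram B y ∂(reducedSecondMoment P Φ) := by
  have h := lintegral_measure_mul_measure_translate hlf hΦ hsq hB 0
  simp only [add_zero, Set.preimage_id'] at h
  rw [← h]
  simp_rw [sq]

theorem lintegral_measure_eq (hlf : ∀ ω, IsLocallyFiniteMeasure (Φ ω))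
    (hΦ : InvariantMeasure Φ) {B : Set (E d)} (hB : MeasurableSet B) :
    ∫⁻ ω, Φ ω B ∂P = intensity P Φ * volume B := by
  have h := lintegral_lintegral_eq_intensity_mul (P := P) hlf hΦ (f := B.indicator 1)
    (measurable_one.indicator hB)
  simpa [lintegral_indicator_one hB] using h

variable {W : Set (E d)}

theorem normalizedVariance_eq_decoupledVariance (hlf : ∀ ω, IsLocallyFiniteMeasure (Φ ω))
    (hΦ : InvariantMeasure Φ) (hsq : LocallySquareIntegrable P Φ) (hW : IsWindow W)
    {r : ℝ} (hr : 0 < r) :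
    normalizedVariance P Φ W r = decoupledVariance (reducedSecondMoment P Φ)
      (intensity P Φ).toReal (Measure.dirac 0) W r := by
  have hB := (hW.smul hr).measurableSet
  have hc := measurable_covariogram hB
  rw [normalizedVariance, variance_toReal_eq (Φ.measurable_coe hB)
    (hsq _ hB (hW.smul hr).isBounded).ne, lintegral_measure_sq_eq hlf hΦ hsq hB,
    lintegral_measure_eq hlf hΦ hB, ENNReal.toReal_mul, decoupledVariance]
  congr 4
  ext1 y
  rw [lintegral_dirac' _ (by fun_prop)]
  simp

/-- Independent displacements do not increase second moments. -/
theorem lintegral_lintegral_covariogram_le (hlf : ∀ ω, IsLocallyFiniteMeasure (Φ ω))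
    (hΦ : InvariantMeasure Φ) (hsq : LocallySquareIntegrable P Φ)
    (π : Measure (E d × E d)) [IsProbabilityMeasure π] {B : Set (E d)} (hB : MeasurableSet B) :
    ∫⁻ y, ∫⁻ p, covariogram B (y + (p.1 - p.2)) ∂π ∂(reducedSecondMoment P Φ)
      ≤ ∫⁻ ω, Φ ω B ^ 2 ∂P := by
  have := sigmaFinite_reducedSecondMoment hlf hsq
  have hc := measurable_covariogram hB
  rw [lintegral_lintegral_swap (by fun_prop)]
  calc _ ≤ ∫⁻ _, ∫⁻ ω, Φ ω B ^ 2 ∂P ∂π :=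
        lintegral_mono fun p => lintegral_covariogram_le hlf hΦ hsq hB _
    _ = _ := by simp

/-- Independent displacements do not increase variances. -/
theorem decoupledVariance_le (hlf : ∀ ω, IsLocallyFiniteMeasure (Φ ω))
    (hΦ : InvariantMeasure Φ) (hsq : LocallySquareIntegrable P Φ) (hW : IsWindow W)
    (π : Measure (E d × E d)) [IsProbabilityMeasure π] {r : ℝ} (hr : 0 < r) :
    decoupledVariance (reducedSecondMoment P Φ) (intensity P Φ).toReal π W r
      ≤ normalizedVariance P Φ W r := by
  have hB := (hW.smul hr).measurableSet
  have hfin := (hsq _ hB (hW.smul hr).isBounded).ne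
  rw [normalizedVariance, variance_toReal_eq (Φ.measurable_coe hB) hfin,
    lintegral_measure_eq hlf hΦ hB, ENNReal.toReal_mul, decoupledVariance]
  gcongr
  exact lintegral_lintegral_covariogram_le hlf hΦ hsq π hB

variable {K : Kernel (Ω × E d) (E d)} [IsMarkovKernel K] {Q : Kernel (E d) Ω}
  {π : Measure (E d × E d)} [IsProbabilityMeasure π]

theorem lintegral_destination_sq_lt_top (hlf : ∀ ω, IsLocallyFiniteMeasure (Φ ω))
    (hΦ : InvariantMeasure Φ) (hsq : LocallySquareIntegrable P Φ) (hK : InvariantKernel K)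
    (hQ : IsTwoPointPalm P Φ Q)
    (hπ : ∫⁻ y, tvNormSub (displacementPair K Q y) π ∂(reducedSecondMoment P Φ) < ∞)
    (hW : IsWindow W) {r : ℝ} (hr : 0 < r) :
    ∫⁻ ω, destination K Φ ω (r • W) ^ 2 ∂P < ∞ := by
  have := hQ.isMarkovKernel
  have hB := (hW.smul hr).measurableSet
  rw [lintegral_destination_sq hlf hΦ hsq hK hQ hB]
  refine (lintegral_covariogram_le_add_decouplingError (π := π) hW hr).1.trans_lt ?_
  refine ENNReal.add_lt_top.2 ⟨?_, ENNReal.mul_lt_top (hW.smul hr).volume_ne_top.lt_top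
    (decouplingError_lt_top hW hπ hr)⟩
  exact (lintegral_lintegral_covariogram_le hlf hΦ hsq π hB).trans_lt
    (hsq _ hB (hW.smul hr).isBounded)

theorem locallySquareIntegrable_destination (hlf : ∀ ω, IsLocallyFiniteMeasure (Φ ω))
    (hΦ : InvariantMeasure Φ) (hsq : LocallySquareIntegrable P Φ) (hK : InvariantKernel K)
    (hQ : IsTwoPointPalm P Φ Q)
    (hπ : ∫⁻ y, tvNormSub (displacementPair K Q y) π ∂(reducedSecondMoment P Φ) < ∞) :
    LocallySquareIntegrable P (destination K Φ) := by
  intro B _ hb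
  obtain ⟨R, hR, hBR⟩ := hb.subset_ball_lt 0 0
  have h := lintegral_destination_sq_lt_top hlf hΦ hsq hK hQ hπ (isWindow_ball hR) one_pos
  rw [one_smul] at h
  exact (lintegral_mono fun ω => by gcongr).trans_lt h

/-- The variance of `KΦ` differs from the variance under independent displacements by at most the
decoupling error. -/
theorem abs_normalizedVariance_destination_sub_le (hlf : ∀ ω, IsLocallyFiniteMeasure (Φ ω))
    (hΦ : InvariantMeasure Φ) (hsq : LocallySquareIntegrable P Φ) (hK : InvariantKernel K)
    (hQ : IsTwoPointPalm P Φ Q)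
    (hπ : ∫⁻ y, tvNormSub (displacementPair K Q y) π ∂(reducedSecondMoment P Φ) < ∞)
    (hW : IsWindow W) {r : ℝ} (hr : 0 < r) :
    |normalizedVariance P (destination K Φ) W r
        - decoupledVariance (reducedSecondMoment P Φ) (intensity P Φ).toReal π W r|
      ≤ (decouplingError (reducedSecondMoment P Φ) (displacementPair K Q) π W r).toReal := by
  have := isSFiniteKernel_of_locallyFinite Φ hlf
  have := hQ.isMarkovKernel
  have hB := (hW.smul hr).measurableSet
  have hV := volume_smul_toReal_pos hW hr
  have hfin := lintegral_destination_sq_lt_top hlf hΦ hsq hK hQ hπ hW hr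
  have hfin' := (lintegral_lintegral_covariogram_le hlf hΦ hsq π hB).trans_lt
    (hsq _ hB (hW.smul hr).isBounded)
  have herr := decouplingError_lt_top hW hπ hr
  have hVerr := ENNReal.mul_lt_top (hW.smul hr).volume_ne_top.lt_top herr
  obtain ⟨h1, h2⟩ := lintegral_covariogram_le_add_decouplingError (α := reducedSecondMoment P Φ)
    (ν := displacementPair K Q) (π := π) hW hr
  rw [normalizedVariance, variance_toReal_eq (measurable_destination_apply hB) hfin.ne,
    lintegral_destination hlf hΦ hK hB, ENNReal.toReal_mul, decoupledVariance]
  rw [lintegral_destination_sq hlf hΦ hsq hK hQ hB] at hfin ⊢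
  replace h1 := ENNReal.toReal_mono (ENNReal.add_lt_top.2 ⟨hfin', hVerr⟩).ne h1
  replace h2 := ENNReal.toReal_mono (ENNReal.add_lt_top.2 ⟨hfin, hVerr⟩).ne h2
  rw [ENNReal.toReal_add hfin'.ne hVerr.ne, ENNReal.toReal_mul] at h1
  rw [ENNReal.toReal_add hfin.ne hVerr.ne, ENNReal.toReal_mul] at h2
  rw [← mul_sub, sub_sub_sub_cancel_right, abs_mul, abs_of_pos (inv_pos.2 hV), inv_mul_le_iff₀ hV,
    abs_le]
  constructor <;> linarith

/-- If the intensity vanishes, so does the reduced second moment measure. -/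
theorem reducedSecondMoment_eq_zero (hlf : ∀ ω, IsLocallyFiniteMeasure (Φ ω))
    (hΦ : InvariantMeasure Φ) (hsq : LocallySquareIntegrable P Φ) (h0 : intensity P Φ = 0) :
    reducedSecondMoment P Φ = 0 := by
  have hC := measurableSet_unitCube d
  have h := lintegral_mul_lintegral_eq hlf hΦ hsq (f := (unitCube d).indicator 1) (g := fun _ => 1)
    (measurable_one.indicator hC) measurable_const
  simp only [mul_one, lintegral_indicator_one hC, volume_unitCube, lintegral_one] at h
  rw [← Measure.measure_univ_eq_zero, ← h]
  rw [intensity, lintegral_eq_zero_iff (Φ.measurable_coe hC)] at h0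
  refine lintegral_eq_zero_of_ae_eq_zero ?_
  filter_upwards [h0] with ω hω
  simp [hω]

end Variance

/-! ### The mean relative displacement -/

section Palm

variable {d : ℕ} {Ω : Type*} [MeasurableSpace Ω] [AddAction (E d) Ω] [MeasurableVAdd₂ (E d) Ω]
  {P : Measure Ω} [IsProbabilityMeasure P] {Φ : Kernel Ω (E d)}
  {K : Kernel (Ω × E d) (E d)} [IsMarkovKernel K]

/-- For positive intensity the Palm measure, and hence the mean relative displacement, is a
probability measure. -/
theorem isProbabilityMeasure_meanRelKernel (hlf : ∀ ω, IsLocallyFiniteMeasure (Φ ω))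
    (hsq : LocallySquareIntegrable P Φ) (hK : InvariantKernel K) (h0 : intensity P Φ ≠ 0) :
    IsProbabilityMeasure (meanRelKernel P Φ K) := by
  have := isSFiniteKernel_of_locallyFinite Φ hlf
  have hm : Measurable fun ω => ((Φ ω).restrict (unitCube d)).map fun x => x +ᵥ ω := by
    convert (((Φ.restrict (measurableSet_unitCube d)) ×ₖ Kernel.id).map
      fun p : E d × Ω => p.1 +ᵥ p.2).measurable with ω
    rw [Kernel.map_apply _ (by fun_prop), Kernel.prod_apply, Kernel.id_apply,
      Kernel.restrict_apply, Measure.prod_dirac, Measure.map_map (by fun_prop) (by fun_prop)]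
    rfl
  have hpalm : palm P Φ Set.univ = 1 := by
    rw [palm, Measure.smul_apply, Measure.bind_apply MeasurableSet.univ hm.aemeasurable]
    have : ∀ ω, ((Φ ω).restrict (unitCube d)).map (fun x => x +ᵥ ω) Set.univ
        = Φ ω (unitCube d) := fun ω => by
      rw [Measure.map_apply (by fun_prop) MeasurableSet.univ]; simp
    simp_rw [this]
    exact ENNReal.inv_mul_cancel h0 (intensity_ne_top hsq)
  have e : (fun ω => relKernel K ω 0) = K.comap (fun ω : Ω => (ω, (0 : E d))) (by fun_prop) := by
    ext1 ω
    rw [hK.relKernel_eq, zero_vadd, Kernel.comap_apply]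
  have : IsProbabilityMeasure (palm P Φ) := ⟨hpalm⟩
  rw [meanRelKernel, e]
  infer_instance

end Palm

/-! ### Variances as integrals against the covariance measure -/

section MeanCorrelation

variable {d : ℕ} {W : Set (E d)} {α : Measure (E d)} {π : Measure (E d × E d)}
  [IsProbabilityMeasure π]

theorem meanWindowCorr_nonneg (π : Measure (E d × E d)) (W : Set (E d)) (r : ℝ) (y : E d) :
    0 ≤ meanWindowCorr π W r y :=
  integral_nonneg fun _ => windowCorr_nonneg _ _ _

theorem meanWindowCorr_le_one (hW : IsWindow W) {r : ℝ} (hr : 0 < r) (y : E d) :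
    meanWindowCorr π W r y ≤ 1 := by
  calc meanWindowCorr π W r y ≤ ∫ _, (1 : ℝ) ∂π :=
        integral_mono (integrable_windowCorr_comp π hW hr (by fun_prop)) (integrable_const 1)
          fun p => windowCorr_le_one hW hr _
    _ = 1 := by simp

theorem measurable_meanWindowCorr (hW : IsWindow W) {r : ℝ} (hr : 0 < r) :
    Measurable (meanWindowCorr π W r) := by
  have h := measurable_integral_windowCorr_kernel (ν := Kernel.const _ π) hW hr
  simp only [Kernel.const_apply] at h
  exact h

theorem lintegral_meanWindowCorr (hW : IsWindow W) {r : ℝ} (hr : 0 < r) :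
    ∫⁻ y, ENNReal.ofReal (meanWindowCorr π W r y) = volume (r • W) := by
  have hB := (hW.smul hr).measurableSet
  have hc := measurable_covariogram hB
  have hV := (hW.smul hr).volume_pos.ne'
  have h : volume (r • W) * ∫⁻ y, ENNReal.ofReal (meanWindowCorr π W r y)
      = volume (r • W) * volume (r • W) := by
    rw [← lintegral_const_mul _ (measurable_meanWindowCorr hW hr).ennreal_ofReal]
    simp_rw [← lintegral_covariogram_comp_eq hW hr]
    rw [lintegral_lintegral_swap (by fun_prop)]
    simp_rw [lintegral_covariogram hB]
    simp [sq]
  exact (ENNReal.mul_right_inj hV (hW.smul hr).volume_ne_top).1 h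

theorem integral_meanWindowCorr (hW : IsWindow W) {r : ℝ} (hr : 0 < r) :
    Integrable (meanWindowCorr π W r) volume ∧
      ∫ y, meanWindowCorr π W r y = (volume (r • W)).toReal := by
  have hm := measurable_meanWindowCorr (π := π) hW hr
  have h0 : 0 ≤ᵐ[volume] meanWindowCorr π W r :=
    Eventually.of_forall (meanWindowCorr_nonneg π W r)
  constructor
  · rw [← lintegral_ofReal_ne_top_iff_integrable hm.aestronglyMeasurable h0,
      lintegral_meanWindowCorr hW hr]
    exact (hW.smul hr).volume_ne_top
  · rw [integral_eq_lintegral_of_nonneg_ae h0 hm.aestronglyMeasurable,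
      lintegral_meanWindowCorr hW hr]

theorem tendsto_meanWindowCorr (hW : IsWindow W) (y : E d) :
    Tendsto (fun r => meanWindowCorr π W r y) atTop (𝓝 1) :=
  tendsto_integral_windowCorr π hW (by fun_prop)

/-- The variance under independent displacements is the integral of the mean correlation with
respect to the covariance measure `α - g² λ_d`. -/
theorem decoupledVariance_eq_integral (hW : IsWindow W) {r : ℝ} (hr : 0 < r) (g : ℝ≥0∞)
    (hfin : ∫⁻ y, ∫⁻ p, covariogram (r • W) (y + (p.1 - p.2)) ∂π ∂α < ∞) :
    Integrable (meanWindowCorr π W r) α ∧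
    decoupledVariance α g.toReal π W r
      = ∫ y, meanWindowCorr π W r y ∂α - ∫ y, meanWindowCorr π W r y ∂(g ^ 2 • volume) := by
  have hm := measurable_meanWindowCorr (π := π) hW hr
  have hV := volume_smul_toReal_pos hW hr
  have h0 : 0 ≤ᵐ[α] meanWindowCorr π W r :=
    Eventually.of_forall (meanWindowCorr_nonneg π W r)
  have e : ∫⁻ y, ∫⁻ p, covariogram (r • W) (y + (p.1 - p.2)) ∂π ∂α
      = volume (r • W) * ∫⁻ y, ENNReal.ofReal (meanWindowCorr π W r y) ∂α := by
    simp_rw [lintegral_covariogram_comp_eq hW hr]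
    rw [lintegral_const_mul _ hm.ennreal_ofReal]
  constructor
  · rw [← lintegral_ofReal_ne_top_iff_integrable hm.aestronglyMeasurable h0]
    intro h
    rw [e, h, ENNReal.mul_top (hW.smul hr).volume_pos.ne'] at hfin
    exact hfin.ne rfl
  · rw [decoupledVariance, e, ENNReal.toReal_mul, integral_smul_measure,
      (integral_meanWindowCorr hW hr).2,
      integral_eq_lintegral_of_nonneg_ae h0 hm.aestronglyMeasurable, ENNReal.toReal_pow, smul_eq_mul]
    field_simp

end MeanCorrelation

/-! ### Covariance measures of finite total variation -/

section FiniteCovarianceMeasure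

variable {d : ℕ}

/-- If the difference of two locally finite measures has finite total variation, then it has an
integrable density with respect to a dominating measure. -/
theorem exists_integrable_density_sub {α τ : Measure (E d)}
    (hα : ∀ n : ℕ, α (Metric.ball 0 n) < ∞) (hτ : ∀ n : ℕ, τ (Metric.ball 0 n) < ∞)
    (htv : ⨆ n : ℕ, tvNormSub (α.restrict (Metric.ball 0 n)) (τ.restrict (Metric.ball 0 n)) < ∞) :
    ∃ (m : Measure (E d)) (b : E d → ℝ), Integrable b m ∧
      ∀ f : E d → ℝ, Integrable f α → Integrable f τ →
        ∫ y, f y ∂α - ∫ y, f y ∂τ = ∫ y, f y * b y ∂m := by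
  have : SigmaFinite α := ⟨⟨⟨fun n => Metric.ball 0 n, fun _ => trivial, hα,
    Metric.iUnion_ball_nat 0⟩⟩⟩
  have : SigmaFinite τ := ⟨⟨⟨fun n => Metric.ball 0 n, fun _ => trivial, hτ,
    Metric.iUnion_ball_nat 0⟩⟩⟩
  set m := α + τ with hm
  have hαm : α ≪ m := Measure.absolutelyContinuous_of_le (Measure.le_add_right le_rfl)
  have hτm : τ ≪ m := Measure.absolutelyContinuous_of_le (Measure.le_add_left le_rfl)
  set b : E d → ℝ := fun y => (α.rnDeriv m y).toReal - (τ.rnDeriv m y).toReal with hb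
  have hbm : Measurable b :=
    (Measure.measurable_rnDeriv α m).ennreal_toReal.sub
      (Measure.measurable_rnDeriv τ m).ennreal_toReal
  have key : ∀ f : E d → ℝ, Integrable f α → Integrable f τ →
      Integrable (fun y => f y * b y) m ∧ ∫ y, f y ∂α - ∫ y, f y ∂τ = ∫ y, f y * b y ∂m := by
    intro f h1 h2
    have i1 := (integrable_rnDeriv_smul_iff hαm).2 h1
    have i2 := (integrable_rnDeriv_smul_iff hτm).2 h2
    have e : (fun y => f y * b y) = fun y => (α.rnDeriv m y).toReal • f y
        - (τ.rnDeriv m y).toReal • f y := by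
      ext y
      simp only [hb, smul_eq_mul]
      ring
    rw [e, integral_sub i1 i2, integral_rnDeriv_smul hαm, integral_rnDeriv_smul hτm]
    exact ⟨i1.sub i2, rfl⟩
  refine ⟨m, b, ⟨hbm.aestronglyMeasurable, ?_⟩, fun f h1 h2 => (key f h1 h2).2⟩
  -- Testing the difference with the sign of its density gives the total variation.
  set s : E d → ℝ := fun y => if 0 ≤ b y then 1 else -1 with hs
  have hsm : Measurable s :=
    Measurable.ite (measurableSet_le measurable_const hbm) measurable_const measurable_const
  have hs1 : ∀ y, s y ∈ Set.Icc (-1 : ℝ) 1 := by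
    intro y
    simp only [hs]
    split_ifs <;> simp
  have hsb : ∀ y, s y * b y = ‖b y‖ := by
    intro y
    simp only [hs, Real.norm_eq_abs]
    split_ifs with h
    · rw [one_mul, abs_of_nonneg h]
    · rw [neg_one_mul, abs_of_neg (not_le.1 h)]
  have hball : ∀ n : ℕ, MeasurableSet (Metric.ball (0 : E d) n) := fun n =>
    Metric.isOpen_ball.measurableSet
  have hsint : ∀ (ρ : Measure (E d)) (n : ℕ), ρ (Metric.ball 0 n) < ∞ →
      Integrable ((Metric.ball 0 (n : ℝ)).indicator s) ρ := by
    intro ρ n h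
    rw [integrable_indicator_iff (hball n)]
    have : IsFiniteMeasure (ρ.restrict (Metric.ball 0 n)) := ⟨by simpa using h⟩
    exact Integrable.of_bound hsm.aestronglyMeasurable 1
      (Eventually.of_forall fun y => abs_le.2 (hs1 y))
  have hle : ∀ n : ℕ, ∫⁻ y in Metric.ball 0 n, ‖b y‖ₑ ∂m ≤
      ⨆ n : ℕ, tvNormSub (α.restrict (Metric.ball 0 n)) (τ.restrict (Metric.ball 0 n)) := by
    intro n
    obtain ⟨h1, h2⟩ := key _ (hsint α n (hα n)) (hsint τ n (hτ n))
    have e : (fun y => (Metric.ball 0 (n : ℝ)).indicator s y * b y)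
        = (Metric.ball 0 (n : ℝ)).indicator fun y => ‖b y‖ := by
      ext y
      by_cases hy : y ∈ Metric.ball (0 : E d) n
      · rw [Set.indicator_of_mem hy, Set.indicator_of_mem hy, hsb]
      · rw [Set.indicator_of_notMem hy, Set.indicator_of_notMem hy, zero_mul]
    rw [e] at h1 h2
    rw [integral_indicator (hball n), integral_indicator (hball n), integral_indicator (hball n)]
      at h2
    rw [integrable_indicator_iff (hball n)] at h1
    have h3 : ∫⁻ y in Metric.ball 0 n, ‖b y‖ₑ ∂m
        = ENNReal.ofReal (∫ y in Metric.ball 0 n, ‖b y‖ ∂m) := by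
      rw [ofReal_integral_norm_eq_lintegral_enorm]
      exact (integrable_norm_iff hbm.aestronglyMeasurable).1 h1
    rw [h3, ← h2]
    refine le_trans (le_trans (ENNReal.ofReal_le_ofReal (le_abs_self _))
      (ofReal_abs_integral_sub_le_tvNormSub _ _ hsm hs1)) ?_
    exact le_iSup (fun n : ℕ =>
      tvNormSub (α.restrict (Metric.ball 0 n)) (τ.restrict (Metric.ball 0 n))) n
  rw [HasFiniteIntegral, ← setLIntegral_univ, ← Metric.iUnion_ball_nat (0 : E d),
    setLIntegral_iUnion_of_directed]
  · exact (iSup_le hle).trans_lt htv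
  · exact directed_of_isDirected_le fun i j hij => Metric.ball_subset_ball (by exact_mod_cast hij)

variable {W : Set (E d)} {α : Measure (E d)}

/-- If the covariance measure has finite total variation, then asymptotic variances exist and are
not changed by independent displacements. -/
theorem exists_tendsto_decoupledVariance (hW : IsWindow W) {g : ℝ≥0∞} (hg : g ≠ ∞)
    (hα : ∀ n : ℕ, α (Metric.ball 0 n) < ∞)
    (htv : ⨆ n : ℕ, tvNormSub (α.restrict (Metric.ball 0 n))
      ((g ^ 2 • (volume : Measure (E d))).restrict (Metric.ball 0 n)) < ∞) :
    ∃ L : ℝ, ∀ (π : Measure (E d × E d)) [IsProbabilityMeasure π],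
      (∀ r : ℝ, 0 < r → ∫⁻ y, ∫⁻ p, covariogram (r • W) (y + (p.1 - p.2)) ∂π ∂α < ∞) →
      Tendsto (decoupledVariance α g.toReal π W) atTop (𝓝 L) := by
  obtain ⟨m, b, hb, h⟩ := exists_integrable_density_sub hα (τ := g ^ 2 • volume) (fun n =>
    ENNReal.mul_lt_top (by finiteness) Metric.isBounded_ball.measure_lt_top) htv
  refine ⟨∫ y, 1 * b y ∂m, fun π _ hfin => ?_⟩
  have ht : Tendsto (fun r => ∫ y, meanWindowCorr π W r y * b y ∂m) atTop
      (𝓝 (∫ y, 1 * b y ∂m)) := by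
    refine tendsto_integral_filter_of_dominated_convergence (fun y => ‖b y‖) ?_ ?_ hb.norm
      (Eventually.of_forall fun y => (tendsto_meanWindowCorr hW y).mul_const _)
    · filter_upwards [eventually_gt_atTop 0] with r hr
      exact (measurable_meanWindowCorr hW hr).aestronglyMeasurable.mul hb.aestronglyMeasurable
    · filter_upwards [eventually_gt_atTop 0] with r hr
      refine Eventually.of_forall fun y => ?_
      rw [norm_mul, Real.norm_of_nonneg (meanWindowCorr_nonneg π W r y)]
      exact mul_le_of_le_one_left (norm_nonneg _) (meanWindowCorr_le_one hW hr y)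
  refine ht.congr' ?_
  filter_upwards [eventually_gt_atTop 0] with r hr
  obtain ⟨h1, h2⟩ := decoupledVariance_eq_integral hW hr g (hfin r hr)
  rw [h2, h _ h1 ((integral_meanWindowCorr hW hr).1.smul_measure (by finiteness))]

end FiniteCovarianceMeasure

/-! ### Positive definiteness of the covariance measure -/

section PositiveDefinite

variable {d : ℕ}

theorem integral_bind_kernel {X Y : Type*} [MeasurableSpace X] [MeasurableSpace Y] {μ : Measure X}
    {κ : Kernel X Y} {f : Y → ℝ} (hf : Integrable f (μ.bind κ)) :
    ∫ y, f y ∂(μ.bind κ) = ∫ x, ∫ y, f y ∂(κ x) ∂μ := by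
  rw [Measure.comp_eq_comp_const_apply] at hf ⊢
  rw [Kernel.integral_comp hf, Kernel.const_apply]

theorem integrable_integral_of_bind {X Y : Type*} [MeasurableSpace X] [MeasurableSpace Y]
    {μ : Measure X} {κ : Kernel X Y} {f : Y → ℝ} (hf : Integrable f (μ.bind κ)) :
    Integrable (fun x => ∫ y, f y ∂(κ x)) μ := by
  rw [Measure.comp_eq_comp_const_apply] at hf
  simpa using hf.integral_comp

theorem integrable_mul_translate {τ : Measure (E d)} [SigmaFinite τ] {B : Set (E d)}
    (hB : MeasurableSet B) (hτ : ∫⁻ y, covariogram B y ∂τ ≠ ∞) {F : E d → ℝ} (hF : Measurable F)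
    (hFB : ∀ x, ‖F x‖ₑ ≤ B.indicator 1 x) :
    Integrable (fun q : E d × E d => F q.1 * F (q.1 + q.2)) (volume.prod τ) := by
  refine ⟨(by fun_prop : Measurable _).aestronglyMeasurable, ?_⟩
  rw [HasFiniteIntegral, lintegral_prod_symm' _ (by fun_prop)]
  refine lt_of_le_of_lt (lintegral_mono fun y => ?_) hτ.lt_top
  rw [covariogram_eq_lintegral hB]
  refine lintegral_mono fun x => ?_
  simp only [enorm_mul]
  exact mul_le_mul' (hFB _) (hFB _)

theorem sq_integral_eq {B : Set (E d)} (hB : MeasurableSet B) (hBfin : volume B ≠ ∞)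
    {F : E d → ℝ} (hF : Measurable F) (hFB : ∀ x, ‖F x‖ₑ ≤ B.indicator 1 x) :
    (∫ x, F x) ^ 2 = ∫ y, ∫ x, F x * F (x + y) := by
  have hτ : ∫⁻ y, covariogram B y ≠ ∞ := by
    have := lintegral_covariogram hB 0
    simp only [add_zero] at this
    rw [this]
    finiteness
  rw [integral_integral_swap (f := fun y x => F x * F (x + y))
    (integrable_mul_translate hB hτ hF hFB).swap]
  simp_rw [integral_const_mul, integral_add_left_eq_self (fun y => F y), integral_mul_const]
  rw [sq]

/-- The function `x ↦ cos (2π⟨k, x⟩)` on `B`, extended by zero. -/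
def cosOn (B : Set (E d)) (k : E d) : E d → ℝ :=
  B.indicator fun x => Real.cos (2 * Real.pi * inner ℝ k x)

/-- The function `x ↦ sin (2π⟨k, x⟩)` on `B`, extended by zero. -/
def sinOn (B : Set (E d)) (k : E d) : E d → ℝ :=
  B.indicator fun x => Real.sin (2 * Real.pi * inner ℝ k x)

theorem measurable_cosOn {B : Set (E d)} (hB : MeasurableSet B) (k : E d) :
    Measurable (cosOn B k) :=
  Measurable.indicator (by fun_prop) hB

theorem measurable_sinOn {B : Set (E d)} (hB : MeasurableSet B) (k : E d) :
    Measurable (sinOn B k) :=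
  Measurable.indicator (by fun_prop) hB

theorem enorm_indicator_comp_le (B : Set (E d)) (k : E d) {g : ℝ → ℝ} (hg : ∀ t, |g t| ≤ 1)
    (x : E d) : ‖B.indicator (fun x => g (2 * Real.pi * inner ℝ k x)) x‖ₑ ≤ B.indicator 1 x := by
  by_cases hx : x ∈ B
  · rw [Set.indicator_of_mem hx, Set.indicator_of_mem hx, Pi.one_apply, Real.enorm_eq_ofReal_abs]
    exact ENNReal.ofReal_le_one.2 (hg _)
  · rw [Set.indicator_of_notMem hx, Set.indicator_of_notMem hx, enorm_zero]

theorem enorm_cosOn_le (B : Set (E d)) (k x : E d) : ‖cosOn B k x‖ₑ ≤ B.indicator 1 x :=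
  enorm_indicator_comp_le B k Real.abs_cos_le_one x

theorem enorm_sinOn_le (B : Set (E d)) (k x : E d) : ‖sinOn B k x‖ₑ ≤ B.indicator 1 x :=
  enorm_indicator_comp_le B k Real.abs_sin_le_one x

variable {W : Set (E d)} {r : ℝ}

/-- The autocorrelations of cosine and sine on a window add up to the covariogram times the
cosine. -/
theorem integral_cosOn_add_integral_sinOn (hW : IsWindow W) (hr : 0 < r) (k : E d)
    (τ : Measure (E d)) [SigmaFinite τ] (hτ : ∫⁻ y, covariogram (r • W) y ∂τ ≠ ∞) :
    ∫ y, ∫ x, cosOn (r • W) k x * cosOn (r • W) k (x + y) ∂volume ∂τ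
        + ∫ y, ∫ x, sinOn (r • W) k x * sinOn (r • W) k (x + y) ∂volume ∂τ
      = (volume (r • W)).toReal
        * ∫ y, windowCorr W r y * Real.cos (2 * Real.pi * inner ℝ k y) ∂τ := by
  have hB := (hW.smul hr).measurableSet
  have hV := volume_smul_toReal_pos hW hr
  set B := r • W with hBdef
  have ic := integrable_mul_translate (τ := τ) hB hτ (measurable_cosOn hB k) (enorm_cosOn_le B k)
  have is := integrable_mul_translate (τ := τ) hB hτ (measurable_sinOn hB k) (enorm_sinOn_le B k)
  have isum : Integrable (fun q : E d × E d => cosOn B k q.1 * cosOn B k (q.1 + q.2)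
      + sinOn B k q.1 * sinOn B k (q.1 + q.2)) (volume.prod τ) := ic.add is
  rw [← integral_prod_symm _ ic, ← integral_prod_symm _ is, ← integral_add ic is,
    integral_prod_symm _ isum, ← integral_const_mul]
  refine integral_congr_ae (Eventually.of_forall fun y => ?_)
  have e : ∀ x, cosOn B k x * cosOn B k (x + y) + sinOn B k x * sinOn B k (x + y)
      = (B ∩ (fun x => x + y) ⁻¹' B).indicator
        (fun _ => Real.cos (2 * Real.pi * inner ℝ k y)) x := by
    intro x
    by_cases h1 : x ∈ B <;> by_cases h2 : x + y ∈ B <;>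
      simp only [cosOn, sinOn, Set.indicator, h1, h2, if_true, if_false, Set.mem_inter_iff,
        Set.mem_preimage, and_true, and_false, mul_zero, zero_mul, add_zero]
    rw [inner_add_right, mul_add, Real.cos_add, Real.sin_add]
    conv_rhs =>
      rw [← one_mul (Real.cos _), ← Real.cos_sq_add_sin_sq (2 * Real.pi * inner ℝ k x)]
    ring
  simp only [e]
  rw [integral_indicator (hB.inter ((by fun_prop : Measurable _) hB)), setIntegral_const,
    windowCorr, ← hBdef, smul_eq_mul, Measure.real, covariogram]
  field_simp

theorem IsWindow.lintegral_covariogram_ne_top (hW : IsWindow W) (hr : 0 < r) :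
    ∫⁻ y, covariogram (r • W) y ≠ ∞ := by
  have := lintegral_covariogram (hW.smul hr).measurableSet 0
  simp only [add_zero] at this
  rw [this]
  exact ENNReal.pow_ne_top (hW.smul hr).volume_ne_top

/-- The power spectrum of a window is the Fourier transform of its covariogram. -/
theorem sq_integral_cosOn_add_sq_integral_sinOn (hW : IsWindow W) (hr : 0 < r) (k : E d) :
    (∫ x, cosOn (r • W) k x) ^ 2 + (∫ x, sinOn (r • W) k x) ^ 2
      = (volume (r • W)).toReal
        * ∫ y, windowCorr W r y * Real.cos (2 * Real.pi * inner ℝ k y) := by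
  have hB := (hW.smul hr).measurableSet
  have hV := (hW.smul hr).volume_ne_top
  rw [sq_integral_eq hB hV (measurable_cosOn hB k) (enorm_cosOn_le _ k),
    sq_integral_eq hB hV (measurable_sinOn hB k) (enorm_sinOn_le _ k),
    integral_cosOn_add_integral_sinOn hW hr k volume (hW.lintegral_covariogram_ne_top hr)]

variable {Ω : Type*} [MeasurableSpace Ω] [AddAction (E d) Ω] [MeasurableVAdd₂ (E d) Ω]
  {P : Measure Ω} [IsProbabilityMeasure P] [VAddInvariantMeasure (E d) Ω P] {Φ : Kernel Ω (E d)}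

/-- The square of the mean of the linear statistic `∫ F dΦ` is at most its second moment, expressed
through the reduced second moment measure. -/
theorem sq_intensity_mul_integral_le (hlf : ∀ ω, IsLocallyFiniteMeasure (Φ ω))
    (hΦ : InvariantMeasure Φ) (hsq : LocallySquareIntegrable P Φ)
    {B : Set (E d)} (hB : MeasurableSet B) (hb : Bornology.IsBounded B)
    {F : E d → ℝ} (hF : Measurable F) (hFB : ∀ x, ‖F x‖ₑ ≤ B.indicator 1 x) :
    (intensity P Φ).toReal ^ 2 * (∫ x, F x) ^ 2
      ≤ ∫ y, ∫ x, F x * F (x + y) ∂volume ∂(reducedSecondMoment P Φ) := by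
  have := isSFiniteKernel_of_locallyFinite Φ hlf
  have := sigmaFinite_reducedSecondMoment hlf hsq
  set α := reducedSecondMoment P Φ with hα
  have hint := integrable_mul_translate (τ := α) hB
    (by rw [← lintegral_measure_sq_eq hlf hΦ hsq hB]; exact (hsq B hB hb).ne) hF hFB
  -- The mean measures of `Φ` and of its square.
  have h1 : P.bind Φ = intensity P Φ • volume := by
    refine Measure.ext_of_lintegral _ fun h hh => ?_
    rw [Measure.lintegral_bind (by fun_prop) hh.aemeasurable, lintegral_smul_measure,
      lintegral_lintegral_eq_intensity_mul hlf hΦ hh, smul_eq_mul]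
  have h2 : P.bind (Φ ×ₖ Φ) = (volume.prod α).map fun q => (q.1, q.1 + q.2) := by
    refine Measure.ext_of_lintegral _ fun h hh => ?_
    rw [Measure.lintegral_bind (by fun_prop) hh.aemeasurable, lintegral_map hh (by fun_prop),
      lintegral_prod _ (by fun_prop)]
    have hc := lintegral_twoPointCampbell P hΦ hlf (h := fun p => h (p.1, p.1 + p.2.1))
      (by fun_prop)
    simp only [add_sub_cancel] at hc
    convert hc using 1
    · refine lintegral_congr fun ω => ?_
      rw [Kernel.prod_apply, lintegral_prod _ (by fun_prop)]
    · refine lintegral_congr fun x => ?_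
      rw [hα, reducedSecondMoment_eq P Φ hlf, lintegral_map (by fun_prop) measurable_fst]
  have i2 : Integrable (fun p : E d × E d => F p.1 * F p.2) (P.bind (Φ ×ₖ Φ)) := by
    rw [h2, integrable_map_measure (by fun_prop) (by fun_prop)]
    exact hint
  have i1 : Integrable F (P.bind Φ) := by
    rw [h1]
    refine Integrable.smul_measure ⟨hF.aestronglyMeasurable, ?_⟩ (intensity_ne_top hsq)
    refine (lintegral_mono hFB).trans_lt ?_
    rw [lintegral_indicator_one hB]
    exact hb.measure_lt_top
  have e1 : ∫ ω, ∫ x, F x ∂(Φ ω) ∂P = (intensity P Φ).toReal * ∫ x, F x := by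
    rw [← integral_bind_kernel i1, h1, integral_smul_measure, smul_eq_mul]
  have hpm : ∀ ω, ∫ p, F p.1 * F p.2 ∂((Φ ×ₖ Φ) ω) = (∫ x, F x ∂(Φ ω)) ^ 2 := by
    intro ω
    rw [Kernel.prod_apply, integral_prod_mul, sq]
  have e2 : ∫ ω, (∫ x, F x ∂(Φ ω)) ^ 2 ∂P = ∫ y, ∫ x, F x * F (x + y) ∂volume ∂α := by
    simp_rw [← hpm]
    rw [← integral_bind_kernel i2, h2, integral_map (by fun_prop) (by fun_prop),
      integral_prod_symm _ hint]
  have hmem : MemLp (fun ω => ∫ x, F x ∂(Φ ω)) 2 P := by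
    rw [memLp_two_iff_integrable_sq hF.stronglyMeasurable.integral_kernel.aestronglyMeasurable]
    simp_rw [← hpm]
    exact integrable_integral_of_bind i2
  have hv := variance_nonneg (fun ω => ∫ x, F x ∂(Φ ω)) P
  rw [variance_eq_sub hmem] at hv
  simp only [Pi.pow_apply] at hv
  rw [e1, e2] at hv
  nlinarith [hv]

/-- The covariance measure is positive definite, also after multiplication with a covariogram. -/
theorem integral_windowCorr_mul_cos_le (hlf : ∀ ω, IsLocallyFiniteMeasure (Φ ω))
    (hΦ : InvariantMeasure Φ) (hsq : LocallySquareIntegrable P Φ)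
    (hW : IsWindow W) (hr : 0 < r) (k : E d) :
    ∫ y, windowCorr W r y * Real.cos (2 * Real.pi * inner ℝ k y) ∂(intensity P Φ ^ 2 • volume)
      ≤ ∫ y, windowCorr W r y * Real.cos (2 * Real.pi * inner ℝ k y)
          ∂(reducedSecondMoment P Φ) := by
  have := sigmaFinite_reducedSecondMoment hlf hsq
  have hB := (hW.smul hr).measurableSet
  have hb := (hW.smul hr).isBounded
  have hα : ∫⁻ y, covariogram (r • W) y ∂(reducedSecondMoment P Φ) ≠ ∞ := by
    rw [← lintegral_measure_sq_eq hlf hΦ hsq hB]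
    exact (hsq _ hB hb).ne
  have h := add_le_add
    (sq_intensity_mul_integral_le hlf hΦ hsq hB hb (measurable_cosOn hB k) (enorm_cosOn_le _ k))
    (sq_intensity_mul_integral_le hlf hΦ hsq hB hb (measurable_sinOn hB k) (enorm_sinOn_le _ k))
  rw [← mul_add, sq_integral_cosOn_add_sq_integral_sinOn hW hr k,
    integral_cosOn_add_integral_sinOn hW hr k _ hα, mul_left_comm] at h
  rw [integral_smul_measure, ENNReal.toReal_pow, smul_eq_mul]
  exact le_of_mul_le_mul_left h (volume_smul_toReal_pos hW hr)

end PositiveDefinite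

/-! ### Spectral densities of Fourier smooth windows -/

section SpectralDensity

open Complex in
theorem norm_sq_setIntegral_exp {d : ℕ} {W : Set (E d)} (hW : IsWindow W) (k : E d) :
    ‖∫ x in W, exp (-(I * ((inner ℝ ((2 * Real.pi) • k) x : ℝ) : ℂ)))‖ ^ 2
      = (volume W).toReal * ∫ y, windowCorr W 1 y * Real.cos (2 * Real.pi * inner ℝ k y) := by
  have hfin : IsFiniteMeasure (volume.restrict W) := ⟨by simpa using hW.volume_ne_top.lt_top⟩
  have hi : Integrable (fun x => exp (-(I * ((inner ℝ ((2 * Real.pi) • k) x : ℝ) : ℂ))))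
      (volume.restrict W) := by
    refine Integrable.of_bound (by fun_prop) 1 (Eventually.of_forall fun x => ?_)
    simp [norm_exp]
  have hre : (∫ x in W, exp (-(I * ((inner ℝ ((2 * Real.pi) • k) x : ℝ) : ℂ)))).re
      = ∫ x, cosOn W k x := by
    have := integral_re hi
    simp only [RCLike.re_to_complex] at this
    rw [← this, cosOn, integral_indicator hW.measurableSet]
    refine integral_congr_ae (Eventually.of_forall fun x => ?_)
    simp [exp_re, inner_smul_left]
  have him : (∫ x in W, exp (-(I * ((inner ℝ ((2 * Real.pi) • k) x : ℝ) : ℂ)))).im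
      = -∫ x, sinOn W k x := by
    have := integral_im hi
    simp only [RCLike.im_to_complex] at this
    rw [← this, sinOn, integral_indicator hW.measurableSet, ← integral_neg]
    refine integral_congr_ae (Eventually.of_forall fun x => ?_)
    simp [exp_im, inner_smul_left]
  have h := sq_integral_cosOn_add_sq_integral_sinOn hW one_pos k
  rw [one_smul] at h
  rw [← h, ← normSq_eq_norm_sq, normSq_apply, hre, him]
  ring

theorem windowCorr_neg {d : ℕ} {W : Set (E d)} (hW : IsWindow W) {r : ℝ} (hr : 0 < r) (y : E d) :
    windowCorr W r (-y) = windowCorr W r y := by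
  rw [windowCorr, windowCorr, covariogram_neg (hW.smul hr).measurableSet]

theorem integrable_windowCorr {d : ℕ} {W : Set (E d)} (hW : IsWindow W) {r : ℝ} (hr : 0 < r)
    {τ : Measure (E d)} (hτ : ∫⁻ y, covariogram (r • W) y ∂τ ≠ ∞) :
    Integrable (windowCorr W r) τ := by
  have h := integrable_toReal_of_lintegral_ne_top
    (measurable_covariogram (hW.smul hr).measurableSet).aemeasurable hτ
  exact h.div_const _

open scoped FourierTransform in
theorem fourier_windowCorr {d : ℕ} {W : Set (E d)} (hW : IsWindow W) (k : E d) :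
    𝓕 (fun y => (windowCorr W 1 y : ℂ)) k
      = ((∫ y, windowCorr W 1 y * Real.cos (2 * Real.pi * inner ℝ k y) : ℝ) : ℂ) := by
  have hc := continuous_windowCorr hW one_pos
  have hD := integrable_windowCorr hW one_pos (hW.lintegral_covariogram_ne_top one_pos)
  have hi : Integrable fun y : E d =>
      Complex.exp (((-2 * Real.pi * inner ℝ y k : ℝ) : ℂ) * Complex.I) • (windowCorr W 1 y : ℂ) := by
    refine hD.mono (by fun_prop) (Eventually.of_forall fun y => ?_)
    rw [norm_smul, Complex.norm_exp_ofReal_mul_I, one_mul, Complex.norm_real]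
  rw [Real.fourier_eq']
  apply Complex.ext
  · have := integral_re hi
    simp only [RCLike.re_to_complex] at this
    rw [← this, Complex.ofReal_re]
    refine integral_congr_ae (Eventually.of_forall fun y => ?_)
    simp only [smul_eq_mul, Complex.re_mul_ofReal, Complex.exp_ofReal_mul_I_re]
    rw [mul_comm, real_inner_comm, ← Real.cos_neg]
    congr 2
    ring
  · have := integral_im hi
    simp only [RCLike.im_to_complex] at this
    rw [← this, Complex.ofReal_im]
    simp only [smul_eq_mul, Complex.im_mul_ofReal, Complex.exp_ofReal_mul_I_im]
    -- The integrand is odd.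
    have h := integral_neg_eq_self (fun y : E d =>
      Real.sin (-2 * Real.pi * inner ℝ y k) * windowCorr W 1 y) volume
    simp only [windowCorr_neg hW one_pos, inner_neg_left, mul_neg, Real.sin_neg, neg_mul,
      integral_neg, neg_neg] at h ⊢
    linarith

/-- A Fourier smooth window has a nonnegative integrable spectral density with the decay of a
Bessel kernel. -/
theorem exists_spectral_density {d : ℕ} {W : Set (E d)} (hW : IsWindow W) (hF : FourierSmooth W) :
    ∃ (p : E d → ℝ) (C ϑ : ℝ), 0 ≤ C ∧ 0 < ϑ ∧ (∀ k, 0 ≤ p k) ∧ Continuous p ∧ Integrable p ∧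
      (∀ k, p k ≤ C * (1 + ‖k‖ ^ 2) ^ (-((d : ℝ) + ϑ) / 2)) ∧
      ∀ y, windowCorr W 1 y = ∫ k, p k * Real.cos (2 * Real.pi * inner ℝ k y) := by
  obtain ⟨c, ϑ, hc, hϑ, hb⟩ := hF
  have hcont := continuous_windowCorr hW one_pos
  have hD := integrable_windowCorr hW one_pos (hW.lintegral_covariogram_ne_top one_pos)
  have hV : 0 < (volume W).toReal := ENNReal.toReal_pos hW.volume_pos.ne' hW.volume_ne_top
  set p : E d → ℝ := fun k => ∫ y, windowCorr W 1 y * Real.cos (2 * Real.pi * inner ℝ k y) with hp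
  have hpn : ∀ k, p k = ‖∫ x in W, Complex.exp (-(Complex.I *
      ((inner ℝ ((2 * Real.pi) • k) x : ℝ) : ℂ)))‖ ^ 2 / (volume W).toReal := by
    intro k
    rw [norm_sq_setIntegral_exp hW k, mul_div_cancel_left₀ _ hV.ne']
  have hp0 : ∀ k, 0 ≤ p k := fun k => by rw [hpn]; positivity
  have hpc : Continuous p := by
    refine continuous_of_dominated (bound := fun y => ‖windowCorr W 1 y‖) (fun k => by fun_prop)
      (fun k => Eventually.of_forall fun y => ?_) hD.norm
      (Eventually.of_forall fun y => by fun_prop)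
    rw [norm_mul]
    exact mul_le_of_le_one_right (norm_nonneg _) (Real.abs_cos_le_one _)
  have hpb : ∀ k, p k ≤ c ^ 2 / (volume W).toReal
      * (1 + ‖k‖ ^ 2) ^ (-((d : ℝ) + ϑ) / 2) := by
    intro k
    rw [hpn, div_mul_eq_mul_div]
    gcongr
    have h1 := hb ((2 * Real.pi) • k)
    rw [norm_smul, Real.norm_of_nonneg (by positivity)] at h1
    have h2 : (1 + ‖k‖ ^ 2) ≤ (1 + 2 * Real.pi * ‖k‖) ^ (2 : ℝ) := by
      have := Real.pi_gt_three
      have hk := norm_nonneg k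
      rw [Real.rpow_two]
      nlinarith [mul_nonneg hk hk, mul_nonneg Real.pi_pos.le hk, mul_nonneg (mul_nonneg hk hk)
        (sub_nonneg.2 this.le)]
    calc _ ≤ (c * (1 + 2 * Real.pi * ‖k‖) ^ (-((d : ℝ) + ϑ) / 2)) ^ 2 := by gcongr
      _ = c ^ 2 * ((1 + 2 * Real.pi * ‖k‖) ^ (2 : ℝ)) ^ (-((d : ℝ) + ϑ) / 2) := by
        rw [mul_pow, ← Real.rpow_two ((1 + 2 * Real.pi * ‖k‖) ^ (-((d : ℝ) + ϑ) / 2)),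
          ← Real.rpow_mul (by positivity), ← Real.rpow_mul (by positivity),
          mul_comm (2 : ℝ) (-((d : ℝ) + ϑ) / 2)]
      _ ≤ _ := by
        gcongr ?_ * ?_
        refine Real.rpow_le_rpow_of_nonpos (by positivity) h2 ?_
        have : (0 : ℝ) ≤ d := Nat.cast_nonneg d
        linarith
  have hpi : Integrable p := by
    have h := (integrable_rpow_neg_one_add_norm_sq (E := E d) (μ := volume) (r := d + ϑ)
      (by simpa using hϑ)).const_mul (c ^ 2 / (volume W).toReal)
    refine h.mono' hpc.aestronglyMeasurable (Eventually.of_forall fun k => ?_)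
    rw [Real.norm_of_nonneg (hp0 k)]
    exact hpb k
  refine ⟨p, _, ϑ, by positivity, hϑ, hp0, hpc, hpi, hpb, fun y => ?_⟩
  open scoped FourierTransform in
  have hFp : 𝓕 (fun y => (windowCorr W 1 y : ℂ)) = fun k => (p k : ℂ) :=
    funext fun k => fourier_windowCorr hW k
  have hinv := Continuous.fourierInv_fourier_eq (f := fun y => (windowCorr W 1 y : ℂ))
    (by fun_prop) hD.ofReal (by rw [hFp]; exact hpi.ofReal)
  rw [hFp] at hinv
  have h := congrArg Complex.re (congrFun hinv y)
  rw [Complex.ofReal_re, Real.fourierInv_eq'] at h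
  have hi : Integrable fun k : E d =>
      Complex.exp (((2 * Real.pi * inner ℝ k y : ℝ) : ℂ) * Complex.I) • (p k : ℂ) := by
    refine hpi.mono (by fun_prop) (Eventually.of_forall fun y => ?_)
    rw [norm_smul, Complex.norm_exp_ofReal_mul_I, one_mul, Complex.norm_real]
  have := integral_re hi
  simp only [RCLike.re_to_complex] at this
  rw [← h, ← this]
  refine integral_congr_ae (Eventually.of_forall fun k => ?_)
  simp only [smul_eq_mul, Complex.re_mul_ofReal, Complex.exp_ofReal_mul_I_re]
  rw [mul_comm]

end SpectralDensity

/-! ### Approximate spectral densities of the covariance measure -/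

section SpectralBound

variable {d : ℕ}

theorem integrable_exp_neg_mul_sq_norm {t : ℝ} (ht : 0 < t) :
    Integrable fun k : E d => Real.exp (-t * ‖k‖ ^ 2) := by
  have h := (GaussianFourier.integrable_cexp_neg_mul_sq_norm_add (V := E d) (b := (t : ℂ))
    (by simpa using ht) 0 0).norm
  refine h.congr (Eventually.of_forall fun k => ?_)
  simp [Complex.norm_exp, ← Complex.ofReal_pow]

open scoped FourierTransform in
theorem integral_exp_neg_mul_sq_norm_mul_cos {t : ℝ} (ht : 0 < t) (y : E d) :
    ∫ k : E d, Real.exp (-t * ‖k‖ ^ 2) * Real.cos (2 * Real.pi * inner ℝ k y)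
      = (Real.pi / t) ^ ((d : ℝ) / 2) * Real.exp (-Real.pi ^ 2 * ‖y‖ ^ 2 / t) := by
  have h := fourier_gaussian_innerProductSpace (V := E d) (b := (t : ℂ)) (by simpa using ht) y
  have hi : Integrable fun k : E d =>
      Complex.exp (((-2 * Real.pi * inner ℝ k y : ℝ) : ℂ) * Complex.I)
        • Complex.exp (-(t : ℂ) * (‖k‖ : ℂ) ^ 2) := by
    refine (integrable_exp_neg_mul_sq_norm ht).mono (by fun_prop)
      (Eventually.of_forall fun k => ?_)
    rw [norm_smul, Complex.norm_exp_ofReal_mul_I, one_mul]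
    simp [Complex.norm_exp, ← Complex.ofReal_pow]
  have hre := integral_re hi
  rw [Real.fourier_eq'] at h
  simp only [RCLike.re_to_complex] at hre
  rw [h] at hre
  have e1 : ∀ k : E d, (Complex.exp (((-2 * Real.pi * inner ℝ k y : ℝ) : ℂ) * Complex.I)
        • Complex.exp (-(t : ℂ) * (‖k‖ : ℂ) ^ 2)).re
      = Real.exp (-t * ‖k‖ ^ 2) * Real.cos (2 * Real.pi * inner ℝ k y) := by
    intro k
    have : Complex.exp (-(t : ℂ) * (‖k‖ : ℂ) ^ 2) = ((Real.exp (-t * ‖k‖ ^ 2) : ℝ) : ℂ) := by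
      push_cast; rfl
    rw [this, smul_eq_mul, Complex.re_mul_ofReal, Complex.exp_ofReal_mul_I_re, mul_comm,
      ← Real.cos_neg]
    congr 2
    ring
  have e2 : ((Real.pi : ℂ) / (t : ℂ)) ^ ((Module.finrank ℝ (E d) : ℂ) / 2)
        * Complex.exp (-(Real.pi : ℂ) ^ 2 * (‖y‖ : ℂ) ^ 2 / (t : ℂ))
      = (((Real.pi / t) ^ ((d : ℝ) / 2) * Real.exp (-Real.pi ^ 2 * ‖y‖ ^ 2 / t) : ℝ) : ℂ) := by
    rw [Complex.ofReal_mul, Complex.ofReal_cpow (by positivity)]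
    push_cast
    simp
  rw [e2, Complex.ofReal_re] at hre
  rw [← hre]
  exact integral_congr_ae (Eventually.of_forall fun k => (e1 k).symm)

/-- A lower bound for the Bessel potential as a mixture of Gaussians. -/
theorem ofReal_rpow_neg_le_lintegral {s x : ℝ} (hs : 0 < s) (hx : 0 ≤ x) :
    ENNReal.ofReal ((1 + x) ^ (-s)) ≤ ENNReal.ofReal (Real.exp 1 * s)
      * ∫⁻ t in Set.Ioc (0 : ℝ) 1, ENNReal.ofReal (t ^ (s - 1) * Real.exp (-t * x)) := by
  set a : ℝ := (1 + x)⁻¹ with ha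
  have ha0 : 0 < a := by positivity
  have ha1 : a ≤ 1 := inv_le_one_of_one_le₀ (by linarith)
  have hint : IntegrableOn (fun t : ℝ => t ^ (s - 1) * Real.exp (-1)) (Set.Ioc 0 a) :=
    ((intervalIntegrable_iff_integrableOn_Ioc_of_le ha0.le).1
      (intervalIntegral.intervalIntegrable_rpow' (by linarith))).mul_const _
  have h1 : ∫⁻ t in Set.Ioc (0 : ℝ) a, ENNReal.ofReal (t ^ (s - 1) * Real.exp (-1))
      = ENNReal.ofReal (a ^ s / s * Real.exp (-1)) := by
    rw [← ofReal_integral_eq_lintegral_ofReal hint, integral_mul_const,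
      ← intervalIntegral.integral_of_le ha0.le, integral_rpow (Or.inl (by linarith))]
    · simp [Real.zero_rpow hs.ne']
    · filter_upwards [ae_restrict_mem measurableSet_Ioc] with t ht
      have := ht.1
      positivity
  calc ENNReal.ofReal ((1 + x) ^ (-s))
      = ENNReal.ofReal (Real.exp 1 * s) * ENNReal.ofReal (a ^ s / s * Real.exp (-1)) := by
        rw [← ENNReal.ofReal_mul (by positivity)]
        congr 1
        rw [ha, Real.inv_rpow (by positivity), Real.rpow_neg (by positivity), Real.exp_neg]
        field_simp
    _ = ENNReal.ofReal (Real.exp 1 * s)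
        * ∫⁻ t in Set.Ioc (0 : ℝ) a, ENNReal.ofReal (t ^ (s - 1) * Real.exp (-1)) := by rw [h1]
    _ ≤ ENNReal.ofReal (Real.exp 1 * s)
        * ∫⁻ t in Set.Ioc (0 : ℝ) a, ENNReal.ofReal (t ^ (s - 1) * Real.exp (-t * x)) := by
        refine mul_le_mul_right (setLIntegral_mono' measurableSet_Ioc fun t ht => ?_) _
        have ht0 := ht.1
        refine ENNReal.ofReal_le_ofReal ?_
        gcongr
        have : t * x ≤ a * (1 + x) := mul_le_mul ht.2 (by linarith) hx ha0.le
        rw [ha, inv_mul_cancel₀ (by positivity)] at this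
        linarith
    _ ≤ _ := by
        gcongr

/-- Fubini's theorem for the Fourier transform of the measure with density `D` with respect to
`τ`. -/
theorem integral_mul_integral_cos {τ : Measure (E d)} [SigmaFinite τ] {φ D : E d → ℝ}
    (hφ : Integrable φ) (hD : Integrable D τ) :
    Integrable (fun k => φ k * ∫ y, D y * Real.cos (2 * Real.pi * inner ℝ k y) ∂τ) ∧
      ∫ k, φ k * ∫ y, D y * Real.cos (2 * Real.pi * inner ℝ k y) ∂τ
        = ∫ y, D y * (∫ k, φ k * Real.cos (2 * Real.pi * inner ℝ k y)) ∂τ := by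
  have hi : Integrable (fun q : E d × E d =>
      φ q.1 * (D q.2 * Real.cos (2 * Real.pi * inner ℝ q.1 q.2))) (volume.prod τ) := by
    refine (hφ.mul_prod hD).mono ?_ (Eventually.of_forall fun q => ?_)
    · refine (hφ.aestronglyMeasurable.comp_fst).mul ((hD.aestronglyMeasurable.comp_snd).mul ?_)
      fun_prop
    · rw [norm_mul, norm_mul, norm_mul, ← mul_assoc]
      exact mul_le_of_le_one_right (by positivity) (Real.abs_cos_le_one _)
  constructor
  · simpa only [integral_const_mul] using hi.integral_prod_left
  · have h := integral_integral_swap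
      (f := fun k y => φ k * (D y * Real.cos (2 * Real.pi * inner ℝ k y))) hi
    simp_rw [integral_const_mul] at h
    rw [h]
    refine integral_congr_ae (Eventually.of_forall fun y => ?_)
    simp only [mul_left_comm (φ _), integral_const_mul]

/-- The density of the `N`-th approximation to the spectral measure of `α - τ`: the Fourier
transform of this signed measure after multiplication with the covariogram of `N W`. -/
def spectralApprox (α τ : Measure (E d)) (W : Set (E d)) (N : ℝ) (k : E d) : ℝ :=
  ∫ y, windowCorr W N y * Real.cos (2 * Real.pi * inner ℝ k y) ∂α
    - ∫ y, windowCorr W N y * Real.cos (2 * Real.pi * inner ℝ k y) ∂τ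

variable {W : Set (E d)} {α τ : Measure (E d)} [SigmaFinite α] [SigmaFinite τ]

theorem integral_mul_spectralApprox {N : ℝ} (hα : Integrable (windowCorr W N) α)
    (hτ : Integrable (windowCorr W N) τ) {φ : E d → ℝ} (hφ : Integrable φ) :
    Integrable (fun k => φ k * spectralApprox α τ W N k) ∧
      ∫ k, φ k * spectralApprox α τ W N k
        = ∫ y, windowCorr W N y * (∫ k, φ k * Real.cos (2 * Real.pi * inner ℝ k y)) ∂α
          - ∫ y, windowCorr W N y * (∫ k, φ k * Real.cos (2 * Real.pi * inner ℝ k y)) ∂τ := by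
  obtain ⟨i1, e1⟩ := integral_mul_integral_cos hφ hα
  obtain ⟨i2, e2⟩ := integral_mul_integral_cos hφ hτ
  simp only [spectralApprox, mul_sub]
  exact ⟨i1.sub i2, by rw [integral_sub i1 i2, e1, e2]⟩

theorem measurable_spectralApprox (hW : IsWindow W) {N : ℝ} (hN : 0 < N) :
    Measurable (spectralApprox α τ W N) := by
  have hc := continuous_windowCorr hW hN
  have : ∀ ρ : Measure (E d), SFinite ρ → Measurable fun k =>
      ∫ y, windowCorr W N y * Real.cos (2 * Real.pi * inner ℝ k y) ∂ρ := by
    intro ρ _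
    have h : StronglyMeasurable fun q : E d × E d =>
        windowCorr W N q.2 * Real.cos (2 * Real.pi * inner ℝ q.1 q.2) :=
      Continuous.stronglyMeasurable (by fun_prop)
    exact h.integral_prod_right'.measurable
  exact (this α inferInstance).sub (this τ inferInstance)

/-- The approximate spectral densities have bounded integrals against Gaussians. -/
theorem integral_exp_mul_spectralApprox_le (hW : IsWindow W) {N : ℝ} (hN : 0 < N)
    (hα : Integrable (windowCorr W N) α) (hτ : Integrable (windowCorr W N) τ)
    (hg : Integrable (fun y => Real.exp (-‖y‖ ^ 2)) α) {t : ℝ} (ht0 : 0 < t) (ht1 : t ≤ 1) :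
    ∫ k, Real.exp (-t * ‖k‖ ^ 2) * spectralApprox α τ W N k
      ≤ (Real.pi / t) ^ ((d : ℝ) / 2) * ∫ y, Real.exp (-‖y‖ ^ 2) ∂α := by
  rw [(integral_mul_spectralApprox hα hτ (integrable_exp_neg_mul_sq_norm ht0)).2]
  simp only [integral_exp_neg_mul_sq_norm_mul_cos ht0]
  refine (sub_le_self _ (integral_nonneg fun y => ?_)).trans ?_
  · have := windowCorr_nonneg W N y
    positivity
  rw [← integral_const_mul]
  refine integral_mono_of_nonneg (Eventually.of_forall fun y => ?_) (hg.const_mul _)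
    (Eventually.of_forall fun y => ?_)
  · have := windowCorr_nonneg W N y
    positivity
  · refine (mul_le_of_le_one_left (by positivity) (windowCorr_le_one hW hN y)).trans ?_
    dsimp only
    gcongr
    rw [div_le_iff₀ ht0]
    have h1 : 1 ≤ Real.pi ^ 2 := by nlinarith [Real.pi_gt_three]
    nlinarith [sq_nonneg ‖y‖, mul_nonneg (sq_nonneg ‖y‖) (sub_nonneg.2 ht1),
      mul_nonneg (sq_nonneg ‖y‖) (sub_nonneg.2 h1)]

/-- The approximate spectral densities have bounded integrals against Bessel potentials, in analogy
to the translation boundedness of the spectral measure. -/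
theorem exists_integral_rpow_mul_spectralApprox_le (hW : IsWindow W)
    (hα : ∀ N : ℝ, 0 < N → Integrable (windowCorr W N) α)
    (hτ : ∀ N : ℝ, 0 < N → Integrable (windowCorr W N) τ)
    (hg : Integrable (fun y => Real.exp (-‖y‖ ^ 2)) α)
    (hpos : ∀ N : ℝ, 0 < N → ∀ k, 0 ≤ spectralApprox α τ W N k) {ϑ : ℝ} (hϑ : 0 < ϑ) :
    ∃ M : ℝ, 0 ≤ M ∧ ∀ N : ℝ, 0 < N →
      ∫ k : E d, (1 + ‖k‖ ^ 2) ^ (-((d : ℝ) + ϑ) / 2) * spectralApprox α τ W N k ≤ M := by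
  set s : ℝ := ((d : ℝ) + ϑ) / 2 with hs
  have hd : (0 : ℝ) ≤ d := Nat.cast_nonneg d
  have hs0 : 0 < s := by positivity
  set A : ℝ := ∫ y, Real.exp (-‖y‖ ^ 2) ∂α with hA
  have hA0 : 0 ≤ A := integral_nonneg fun y => (Real.exp_pos _).le
  set M : ℝ≥0∞ := ENNReal.ofReal (Real.exp 1 * s) *
    ∫⁻ t in Set.Ioc (0 : ℝ) 1, ENNReal.ofReal (t ^ (s - 1) * ((Real.pi / t) ^ ((d : ℝ) / 2) * A))
    with hM
  have hMfin : M ≠ ∞ := by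
    refine ENNReal.mul_ne_top ENNReal.ofReal_ne_top ?_
    have hi : IntegrableOn (fun t : ℝ => t ^ (s - 1 - (d : ℝ) / 2)
        * (Real.pi ^ ((d : ℝ) / 2) * A)) (Set.Ioc 0 1) :=
      ((intervalIntegrable_iff_integrableOn_Ioc_of_le zero_le_one).1
        (intervalIntegral.intervalIntegrable_rpow' (by rw [hs]; linarith))).mul_const _
    have hi' : IntegrableOn (fun t : ℝ => t ^ (s - 1) * ((Real.pi / t) ^ ((d : ℝ) / 2) * A))
        (Set.Ioc 0 1) := by
      refine hi.congr_fun (fun t ht => ?_) measurableSet_Ioc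
      have := ht.1
      simp only
      rw [Real.rpow_sub this, Real.div_rpow Real.pi_pos.le this.le]
      ring
    exact (hasFiniteIntegral_iff_ofReal (by
      filter_upwards [ae_restrict_mem measurableSet_Ioc] with t ht
      have := ht.1
      simp only [Pi.zero_apply]
      positivity)).1 hi'.2 |>.ne
  refine ⟨M.toReal, ENNReal.toReal_nonneg, fun N hN => ?_⟩
  have hS := measurable_spectralApprox (α := α) (τ := τ) hW hN
  have e : -((d : ℝ) + ϑ) / 2 = -s := by rw [hs]; ring
  rw [e, integral_eq_lintegral_of_nonneg_ae (Eventually.of_forall fun k =>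
    mul_nonneg (by positivity) (hpos N hN k))
    (by have := hS; fun_prop : Measurable _).aestronglyMeasurable]
  refine ENNReal.toReal_mono hMfin ?_
  calc ∫⁻ k : E d, ENNReal.ofReal ((1 + ‖k‖ ^ 2) ^ (-s) * spectralApprox α τ W N k)
      ≤ ∫⁻ k : E d, ENNReal.ofReal (Real.exp 1 * s) *
          ∫⁻ t in Set.Ioc (0 : ℝ) 1, ENNReal.ofReal (t ^ (s - 1)) *
            ENNReal.ofReal (Real.exp (-t * ‖k‖ ^ 2) * spectralApprox α τ W N k) := by
        refine lintegral_mono fun k => ?_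
        rw [ENNReal.ofReal_mul (by positivity)]
        refine (mul_le_mul_left (ofReal_rpow_neg_le_lintegral hs0 (sq_nonneg ‖k‖)) _).trans_eq ?_
        rw [mul_assoc, ← lintegral_mul_const _ (by fun_prop)]
        congr 1
        refine setLIntegral_congr_fun measurableSet_Ioc fun t ht => ?_
        have := ht.1
        rw [← ENNReal.ofReal_mul (by positivity), ← ENNReal.ofReal_mul (by positivity), mul_assoc]
    _ = ENNReal.ofReal (Real.exp 1 * s) * ∫⁻ t in Set.Ioc (0 : ℝ) 1,
          ENNReal.ofReal (t ^ (s - 1)) * ∫⁻ k : E d,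
            ENNReal.ofReal (Real.exp (-t * ‖k‖ ^ 2) * spectralApprox α τ W N k) := by
        rw [lintegral_const_mul _ (Measurable.lintegral_prod_right' (f := fun q : E d × ℝ =>
          ENNReal.ofReal (q.2 ^ (s - 1)) *
            ENNReal.ofReal (Real.exp (-q.2 * ‖q.1‖ ^ 2) * spectralApprox α τ W N q.1))
          (by fun_prop)), lintegral_lintegral_swap (by fun_prop)]
        congr 1
        refine lintegral_congr fun t => ?_
        dsimp only
        rw [lintegral_const_mul _ (by fun_prop)]
    _ ≤ M := by
        rw [hM]
        refine mul_le_mul_right (setLIntegral_mono' measurableSet_Ioc fun t ht => ?_) _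
        have ht0 := ht.1
        rw [ENNReal.ofReal_mul (by positivity)]
        refine mul_le_mul_right ?_ _
        rw [← ofReal_integral_eq_lintegral_ofReal
          (integral_mul_spectralApprox (hα N hN) (hτ N hN) (integrable_exp_neg_mul_sq_norm ht0)).1
          (Eventually.of_forall fun k => mul_nonneg (Real.exp_pos _).le (hpos N hN k))]
        exact ENNReal.ofReal_le_ofReal
          (integral_exp_mul_spectralApprox_le hW hN (hα N hN) (hτ N hN) hg ht0 ht.2)

end SpectralBound

/-! ### Independent displacements and Fourier smooth windows -/

section FourierSmoothWindows

variable {d : ℕ}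

/-- The squared modulus `k ↦ ∬ cos (2π⟨k, x - y⟩) μ(dx) μ(dy)` of the characteristic function. -/
def sqCharFun (μ : Measure (E d)) (k : E d) : ℝ :=
  ∫ p, Real.cos (2 * Real.pi * inner ℝ k (p.1 - p.2)) ∂(μ.prod μ)

variable {μ : Measure (E d)} [IsProbabilityMeasure μ]

theorem abs_sqCharFun_le (μ : Measure (E d)) [IsProbabilityMeasure μ] (k : E d) :
    |sqCharFun μ k| ≤ 1 := by
  have h := norm_integral_le_of_norm_le_const (μ := μ.prod μ)
    (f := fun p : E d × E d => Real.cos (2 * Real.pi * inner ℝ k (p.1 - p.2))) (C := 1)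
    (Eventually.of_forall fun p => Real.abs_cos_le_one _)
  rw [sqCharFun]
  simpa using h

theorem continuous_sqCharFun (μ : Measure (E d)) [IsProbabilityMeasure μ] :
    Continuous (sqCharFun μ) := by
  refine continuous_of_dominated (bound := fun _ => 1) (fun k => by fun_prop)
    (fun k => Eventually.of_forall fun p => Real.abs_cos_le_one _) (integrable_const 1)
    (Eventually.of_forall fun p => by fun_prop)

theorem sqCharFun_zero (μ : Measure (E d)) [IsProbabilityMeasure μ] : sqCharFun μ 0 = 1 := by
  simp [sqCharFun]

/-- Averaging a plane wave over the difference of two independent displacements multiplies it by the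
squared modulus of their characteristic function. -/
theorem integral_cos_add_sub (μ : Measure (E d)) [IsProbabilityMeasure μ] (k y : E d) :
    ∫ p, Real.cos (2 * Real.pi * inner ℝ k (y + (p.1 - p.2))) ∂(μ.prod μ)
      = sqCharFun μ k * Real.cos (2 * Real.pi * inner ℝ k y) := by
  have hs : ∫ p, Real.sin (2 * Real.pi * inner ℝ k (p.1 - p.2)) ∂(μ.prod μ) = 0 := by
    have h := integral_prod_swap (μ := μ) (ν := μ)
      (fun p : E d × E d => Real.sin (2 * Real.pi * inner ℝ k (p.1 - p.2)))
    have e : ∀ p : E d × E d, Real.sin (2 * Real.pi * inner ℝ k (p.swap.1 - p.swap.2))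
        = -Real.sin (2 * Real.pi * inner ℝ k (p.1 - p.2)) := by
      intro p
      rw [← Real.sin_neg, Prod.fst_swap, Prod.snd_swap, ← neg_sub, inner_neg_right, mul_neg]
    simp only [e, integral_neg] at h
    linarith
  have ic : Integrable (fun p : E d × E d => Real.cos (2 * Real.pi * inner ℝ k (p.1 - p.2)))
      (μ.prod μ) :=
    Integrable.of_bound (by fun_prop) 1 (Eventually.of_forall fun p => Real.abs_cos_le_one _)
  have is : Integrable (fun p : E d × E d => Real.sin (2 * Real.pi * inner ℝ k (p.1 - p.2)))
      (μ.prod μ) :=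
    Integrable.of_bound (by fun_prop) 1 (Eventually.of_forall fun p => Real.abs_sin_le_one _)
  simp_rw [inner_add_right, mul_add, Real.cos_add]
  rw [integral_sub (ic.const_mul _) (is.const_mul _), integral_const_mul, integral_const_mul, hs,
    mul_zero, sub_zero, mul_comm, sqCharFun]

theorem windowCorr_eq_integral_scaled {W : Set (E d)} {p : E d → ℝ}
    (hp : ∀ y, windowCorr W 1 y = ∫ k, p k * Real.cos (2 * Real.pi * inner ℝ k y))
    {r : ℝ} (hr : 0 < r) (y : E d) :
    windowCorr W r y = ∫ k, r ^ d * p (r • k) * Real.cos (2 * Real.pi * inner ℝ k y) := by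
  have h1 : windowCorr W r y = windowCorr W 1 (r⁻¹ • y) := by
    rw [windowCorr_eq W hr, windowCorr_eq W one_pos, inv_one, one_smul]
  have h2 := Measure.integral_comp_smul_of_nonneg volume
    (fun k : E d => p k * Real.cos (2 * Real.pi * inner ℝ k (r⁻¹ • y))) r (hR := hr.le)
  have e : ∀ k : E d, inner ℝ (r • k) (r⁻¹ • y) = inner ℝ k y := by
    intro k
    rw [inner_smul_left, inner_smul_right, RCLike.conj_to_real, mul_inv_cancel_left₀ hr.ne']
  simp only [e, finrank_euclideanSpace_fin, smul_eq_mul] at h2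
  simp_rw [mul_assoc (r ^ d)]
  rw [integral_const_mul, h2, h1, hp, mul_inv_cancel_left₀ (by positivity)]

/-- Independent displacements multiply the spectral density of a window by the squared modulus of
their characteristic function. -/
theorem meanWindowCorr_prod_eq_integral {W : Set (E d)} {r : ℝ} {q : E d → ℝ} (hqi : Integrable q)
    (hq : ∀ y, windowCorr W r y = ∫ k, q k * Real.cos (2 * Real.pi * inner ℝ k y)) (y : E d) :
    meanWindowCorr (μ.prod μ) W r y
      = ∫ k, q k * sqCharFun μ k * Real.cos (2 * Real.pi * inner ℝ k y) := by
  rw [meanWindowCorr]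
  simp_rw [hq]
  have hi : Integrable (fun z : (E d × E d) × E d =>
      q z.2 * Real.cos (2 * Real.pi * inner ℝ z.2 (y + (z.1.1 - z.1.2))))
      ((μ.prod μ).prod volume) := by
    have h1 : Integrable (fun z : (E d × E d) × E d => (1 : ℝ) * q z.2)
        ((μ.prod μ).prod volume) := (integrable_const 1).mul_prod hqi
    refine h1.mono ((hqi.aestronglyMeasurable.comp_snd).mul (by fun_prop))
      (Eventually.of_forall fun z => ?_)
    rw [norm_mul, one_mul]
    exact mul_le_of_le_one_right (norm_nonneg _) (Real.abs_cos_le_one _)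
  rw [integral_integral_swap (f := fun (z : E d × E d) k =>
    q k * Real.cos (2 * Real.pi * inner ℝ k (y + (z.1 - z.2)))) hi]
  refine integral_congr_ae (Eventually.of_forall fun k => ?_)
  dsimp only
  rw [integral_const_mul, integral_cos_add_sub]
  exact (mul_assoc _ _ _).symm

theorem meanWindowCorr_dirac_zero {W : Set (E d)} (hW : IsWindow W) {r : ℝ} (hr : 0 < r) (y : E d) :
    meanWindowCorr (Measure.dirac 0) W r y = windowCorr W r y := by
  have hc := continuous_windowCorr hW hr
  rw [meanWindowCorr, integral_dirac' _ _ (Continuous.stronglyMeasurable (by fun_prop))]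
  simp

/-- Away from the origin the spectral densities of large windows are small against a Bessel
potential. -/
theorem scaled_spectral_density_le {p : E d → ℝ} {C ϑ : ℝ} (hC : 0 ≤ C) (hϑ : 0 < ϑ)
    (hp : ∀ k, p k ≤ C * (1 + ‖k‖ ^ 2) ^ (-((d : ℝ) + ϑ) / 2)) {ε r : ℝ} (hε : 0 < ε)
    (hr : 0 < r) {k : E d} (hk : ε ≤ ‖k‖) :
    r ^ d * p (r • k) ≤ C * ((1 + ε ^ 2) / ε ^ 2) ^ (((d : ℝ) + ϑ) / 2) * r ^ (-ϑ)
      * (1 + ‖k‖ ^ 2) ^ (-((d : ℝ) + ϑ) / 2) := by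
  have hd : (0 : ℝ) ≤ d := Nat.cast_nonneg d
  have hk0 : 0 < ‖k‖ := hε.trans_le hk
  set s : ℝ := ((d : ℝ) + ϑ) / 2 with hs
  have e : -((d : ℝ) + ϑ) / 2 = -s := by rw [hs]; ring
  have hs0 : 0 < s := by positivity
  rw [e] at hp ⊢
  have h1 : ε ^ 2 / (1 + ε ^ 2) * (1 + ‖k‖ ^ 2) ≤ ‖k‖ ^ 2 := by
    rw [div_mul_eq_mul_div, div_le_iff₀ (by positivity)]
    nlinarith [mul_self_le_mul_self hε.le hk]
  have h2 : r ^ 2 * (ε ^ 2 / (1 + ε ^ 2) * (1 + ‖k‖ ^ 2)) ≤ 1 + ‖r • k‖ ^ 2 := by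
    rw [norm_smul, Real.norm_of_nonneg hr.le, mul_pow]
    nlinarith [mul_le_mul_of_nonneg_left h1 (sq_nonneg r)]
  have h3 : (r ^ 2 : ℝ) ^ (-s) = r ^ (-(d : ℝ)) * r ^ (-ϑ) := by
    rw [← Real.rpow_natCast, ← Real.rpow_mul hr.le, ← Real.rpow_add hr]
    congr 1
    rw [hs]
    push_cast
    ring
  calc r ^ d * p (r • k) ≤ r ^ d * (C * (1 + ‖r • k‖ ^ 2) ^ (-s)) := by gcongr; exact hp _
    _ ≤ r ^ d * (C * (r ^ 2 * (ε ^ 2 / (1 + ε ^ 2) * (1 + ‖k‖ ^ 2))) ^ (-s)) := by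
        gcongr ?_ * (?_ * ?_)
        exact Real.rpow_le_rpow_of_nonpos (by positivity) h2 (by linarith)
    _ = (r ^ d * r ^ (-(d : ℝ))) * (C * (ε ^ 2 / (1 + ε ^ 2)) ^ (-s) * r ^ (-ϑ)
          * (1 + ‖k‖ ^ 2) ^ (-s)) := by
        rw [Real.mul_rpow (by positivity) (by positivity),
          Real.mul_rpow (by positivity) (by positivity), h3]
        ring
    _ = _ := by
        rw [Real.rpow_neg hr.le, Real.rpow_natCast, mul_inv_cancel₀ (by positivity), one_mul,
          Real.rpow_neg (x := ε ^ 2 / (1 + ε ^ 2)) (by positivity),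
          ← Real.inv_rpow (by positivity), inv_div]

variable {W : Set (E d)} {α : Measure (E d)} [SigmaFinite α] {g : ℝ≥0∞}

/-- For Fourier smooth windows, independent displacements do not decrease the asymptotic
variance. -/
theorem eventually_decoupledVariance_sub_le (hW : IsWindow W) (hF : FourierSmooth W) (hg : g ≠ ∞)
    (hfin : ∀ (π : Measure (E d × E d)) [IsProbabilityMeasure π] (r : ℝ), 0 < r →
      ∫⁻ y, ∫⁻ p, covariogram (r • W) (y + (p.1 - p.2)) ∂π ∂α < ∞)
    (hexp : Integrable (fun y => Real.exp (-‖y‖ ^ 2)) α)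
    (hpos : ∀ N : ℝ, 0 < N → ∀ k, 0 ≤ spectralApprox α (g ^ 2 • volume) W N k)
    {δ : ℝ} (hδ : 0 < δ) :
    ∀ᶠ r in atTop, decoupledVariance α g.toReal (Measure.dirac 0) W r
        - decoupledVariance α g.toReal (μ.prod μ) W r
      ≤ δ * (decoupledVariance α g.toReal (Measure.dirac 0) W r + 1) := by
  obtain ⟨p, C, ϑ, hC, hϑ, hp0, hpc, hpi, hpC, hprep⟩ := exists_spectral_density hW hF
  set τ : Measure (E d) := g ^ 2 • volume with hτdef
  have hτs : SigmaFinite τ := by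
    have : τ = (g ^ 2).toNNReal • (volume : Measure (E d)) := by
      rw [hτdef, ← ENNReal.coe_toNNReal (ENNReal.pow_ne_top hg)]
      rfl
    rw [this]
    infer_instance
  have hD0 : ∀ r : ℝ, 0 < r → meanWindowCorr (Measure.dirac 0) W r = windowCorr W r :=
    fun r hr => funext fun y => meanWindowCorr_dirac_zero hW hr y
  have hα : ∀ r : ℝ, 0 < r → Integrable (windowCorr W r) α := fun r hr => by
    rw [← hD0 r hr]
    exact (decoupledVariance_eq_integral hW hr g (hfin _ r hr)).1
  have hvol : ∀ r : ℝ, 0 < r → Integrable (windowCorr W r) volume := fun r hr =>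
    integrable_windowCorr hW hr (hW.lintegral_covariogram_ne_top hr)
  have hτ : ∀ r : ℝ, 0 < r → Integrable (windowCorr W r) τ := fun r hr =>
    (hvol r hr).smul_measure (ENNReal.pow_ne_top hg)
  obtain ⟨M, hM0, hM⟩ := exists_integral_rpow_mul_spectralApprox_le hW hα hτ hexp hpos hϑ
  -- Near the origin the squared characteristic function is close to one.
  obtain ⟨ε, hε, hεc⟩ : ∃ ε > 0, ∀ k : E d, ‖k‖ < ε → 1 - sqCharFun μ k ≤ δ := by
    have h : Tendsto (fun k => 1 - sqCharFun μ k) (𝓝 0) (𝓝 (1 - sqCharFun μ 0)) :=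
      (continuous_const.sub (continuous_sqCharFun μ)).tendsto 0
    rw [sqCharFun_zero, sub_self] at h
    obtain ⟨ε, hε, h'⟩ := Metric.eventually_nhds_iff.1 (h.eventually (Iio_mem_nhds hδ))
    exact ⟨ε, hε, fun k hk => (h' (by simpa using hk)).le⟩
  set A : ℝ := C * ((1 + ε ^ 2) / ε ^ 2) ^ (((d : ℝ) + ϑ) / 2) with hA
  have hA0 : 0 ≤ A := by positivity
  have key : ∀ r : ℝ, 0 < r → decoupledVariance α g.toReal (Measure.dirac 0) W r
        - decoupledVariance α g.toReal (μ.prod μ) W r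
      ≤ δ * decoupledVariance α g.toReal (Measure.dirac 0) W r + 2 * A * M * r ^ (-ϑ) := by
    intro r hr
    set q : E d → ℝ := fun k => r ^ d * p (r • k) with hq
    have hq0 : ∀ k, 0 ≤ q k := fun k => mul_nonneg (by positivity) (hp0 _)
    have hqi : Integrable q := (hpi.comp_smul hr.ne').const_mul _
    have hqrep : ∀ y, windowCorr W r y = ∫ k, q k * Real.cos (2 * Real.pi * inner ℝ k y) :=
      fun y => windowCorr_eq_integral_scaled hprep hr y
    have hci : Integrable fun k => q k * sqCharFun μ k := by
      refine hqi.mul_bdd (c := 1) (continuous_sqCharFun μ).aestronglyMeasurable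
        (Eventually.of_forall fun k => abs_sqCharFun_le μ k)
    set φ : E d → ℝ := fun k => q k * (1 - sqCharFun μ k) with hφ
    have hφi : Integrable φ := by
      simp only [hφ, mul_sub, mul_one]
      exact hqi.sub hci
    set J : E d → ℝ := fun y => windowCorr W r y - meanWindowCorr (μ.prod μ) W r y with hJ
    have hcos : ∀ (f : E d → ℝ) (y : E d), Integrable f →
        Integrable fun k => f k * Real.cos (2 * Real.pi * inner ℝ k y) := fun f y hf =>
      hf.mul_bdd (c := 1) (by fun_prop) (Eventually.of_forall fun k => Real.abs_cos_le_one _)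
    have hJrep : ∀ y, ∫ k, φ k * Real.cos (2 * Real.pi * inner ℝ k y) = J y := by
      intro y
      simp only [hJ]
      rw [meanWindowCorr_prod_eq_integral hqi hqrep, hqrep,
        ← integral_sub (hcos q y hqi) (hcos _ y hci)]
      refine integral_congr_ae (Eventually.of_forall fun k => ?_)
      simp only [hφ]
      ring
    obtain ⟨hmα, hv⟩ := decoupledVariance_eq_integral hW hr g (hfin (μ.prod μ) r hr)
    have hmτ : Integrable (meanWindowCorr (μ.prod μ) W r) τ :=
      (integral_meanWindowCorr hW hr).1.smul_measure (ENNReal.pow_ne_top hg)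
    have hv0 := (decoupledVariance_eq_integral hW hr g (hfin (Measure.dirac 0) r hr)).2
    rw [hD0 r hr] at hv0
    have hdiff : decoupledVariance α g.toReal (Measure.dirac 0) W r
        - decoupledVariance α g.toReal (μ.prod μ) W r = ∫ y, J y ∂α - ∫ y, J y ∂τ := by
      rw [hv, hv0]
      simp only [hJ]
      rw [integral_sub (hα r hr) hmα, integral_sub (hτ r hr) hmτ]
      ring
    -- Integrals against the cut-off covariance measure converge.
    have hlim : ∀ f : E d → ℝ, Integrable f α → Integrable f τ →
        Tendsto (fun N => ∫ y, windowCorr W N y * f y ∂α - ∫ y, windowCorr W N y * f y ∂τ) atTop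
          (𝓝 (∫ y, f y ∂α - ∫ y, f y ∂τ)) := by
      have aux : ∀ (ρ : Measure (E d)) (f : E d → ℝ), Integrable f ρ →
          Tendsto (fun N => ∫ y, windowCorr W N y * f y ∂ρ) atTop (𝓝 (∫ y, f y ∂ρ)) := by
        intro ρ f hf
        refine tendsto_integral_filter_of_dominated_convergence (fun y => ‖f y‖) ?_ ?_ hf.norm
          (Eventually.of_forall fun y => ?_)
        · filter_upwards [eventually_gt_atTop 0] with N hN
          exact (continuous_windowCorr hW hN).aestronglyMeasurable.mul hf.aestronglyMeasurable
        · filter_upwards [eventually_gt_atTop 0] with N hN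
          refine Eventually.of_forall fun y => ?_
          rw [norm_mul, Real.norm_of_nonneg (windowCorr_nonneg W N y)]
          exact mul_le_of_le_one_left (norm_nonneg _) (windowCorr_le_one hW hN y)
        · simpa using (tendsto_windowCorr hW y).mul_const (f y)
      exact fun f h1 h2 => (aux α f h1).sub (aux τ f h2)
    have hlimJ := hlim J ((hα r hr).sub hmα) ((hτ r hr).sub hmτ)
    have hlimD := hlim _ (hα r hr) (hτ r hr)
    rw [hdiff, hv0]
    refine le_of_tendsto_of_tendsto hlimJ ((hlimD.const_mul δ).add_const _) ?_
    filter_upwards [eventually_gt_atTop 0] with N hN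
    have hbi : Integrable fun k : E d => (1 + ‖k‖ ^ 2) ^ (-((d : ℝ) + ϑ) / 2) :=
      integrable_rpow_neg_one_add_norm_sq (by simpa using hϑ)
    obtain ⟨i1, e1⟩ := integral_mul_spectralApprox (hα N hN) (hτ N hN) hφi
    obtain ⟨i2, e2⟩ := integral_mul_spectralApprox (hα N hN) (hτ N hN) hqi
    obtain ⟨i3, -⟩ := integral_mul_spectralApprox (hα N hN) (hτ N hN) hbi
    simp only [hJrep] at e1
    simp only [← hqrep] at e2
    rw [← e1, ← e2]
    calc ∫ k, φ k * spectralApprox α τ W N k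
        ≤ ∫ k, (δ * (q k * spectralApprox α τ W N k) + 2 * A * r ^ (-ϑ)
            * ((1 + ‖k‖ ^ 2) ^ (-((d : ℝ) + ϑ) / 2) * spectralApprox α τ W N k)) := by
          refine integral_mono i1 ((i2.const_mul δ).add (i3.const_mul _)) fun k => ?_
          have hS := hpos N hN k
          simp only [hφ]
          have hq1 := hq0 k
          have hb0 : 0 ≤ (1 + ‖k‖ ^ 2) ^ (-((d : ℝ) + ϑ) / 2) := by positivity
          have hr0 : 0 ≤ r ^ (-ϑ) := by positivity
          rw [show δ * (q k * spectralApprox α τ W N k) + 2 * A * r ^ (-ϑ)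
              * ((1 + ‖k‖ ^ 2) ^ (-((d : ℝ) + ϑ) / 2) * spectralApprox α τ W N k)
            = (δ * q k + 2 * A * r ^ (-ϑ) * (1 + ‖k‖ ^ 2) ^ (-((d : ℝ) + ϑ) / 2))
              * spectralApprox α τ W N k by ring]
          refine mul_le_mul_of_nonneg_right ?_ hS
          rcases lt_or_ge ‖k‖ ε with hk | hk
          · have := mul_le_mul_of_nonneg_left (hεc k hk) hq1
            have h' : 0 ≤ 2 * A * r ^ (-ϑ) * (1 + ‖k‖ ^ 2) ^ (-((d : ℝ) + ϑ) / 2) := by positivity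
            linarith
          · have h1 : 1 - sqCharFun μ k ≤ 2 := by linarith [(abs_le.1 (abs_sqCharFun_le μ k)).1]
            have h2 := scaled_spectral_density_le hC hϑ hpC hε hr hk
            have h3 := mul_le_mul_of_nonneg_left h1 hq1
            have h4 : 0 ≤ δ * q k := by positivity
            calc q k * (1 - sqCharFun μ k) ≤ q k * 2 := h3
              _ ≤ (A * r ^ (-ϑ) * (1 + ‖k‖ ^ 2) ^ (-((d : ℝ) + ϑ) / 2)) * 2 := by gcongr
              _ ≤ _ := by linarith
      _ = δ * (∫ k, q k * spectralApprox α τ W N k) + 2 * A * r ^ (-ϑ)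
            * (∫ k, (1 + ‖k‖ ^ 2) ^ (-((d : ℝ) + ϑ) / 2) * spectralApprox α τ W N k) := by
          rw [integral_add (i2.const_mul δ) (i3.const_mul _), integral_const_mul,
            integral_const_mul]
      _ ≤ δ * (∫ k, q k * spectralApprox α τ W N k) + 2 * A * r ^ (-ϑ) * M := by
          gcongr
          exact hM N hN
      _ = _ := by ring
  have hlim0 : Tendsto (fun r : ℝ => 2 * A * M * r ^ (-ϑ)) atTop (𝓝 0) := by
    simpa using (tendsto_rpow_neg_atTop hϑ).const_mul (2 * A * M)
  filter_upwards [eventually_gt_atTop 0, hlim0.eventually (Iio_mem_nhds hδ)] with r hr hsmall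
  have := key r hr
  have hsmall' : 2 * A * M * r ^ (-ϑ) < δ := hsmall
  linarith

end FourierSmoothWindows

/-! ### Comparison of asymptotic variances -/

section Asymptotics

/-- If `v - w` is negligible compared with `v + 1`, then a limit of `v` in `[0, ∞]` is also the
limit of `w`. -/
theorem tendsto_ofReal_of_eventually_abs_sub_le {ι : Type*} {l : Filter ι} {v w : ι → ℝ}
    (hv : ∀ᶠ i in l, 0 ≤ v i)
    (h : ∀ δ : ℝ, 0 < δ → ∀ᶠ i in l, |v i - w i| ≤ δ * (v i + 1)) {σ : ℝ≥0∞}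
    (hσ : Tendsto (fun i => ENNReal.ofReal (v i)) l (𝓝 σ)) :
    Tendsto (fun i => ENNReal.ofReal (w i)) l (𝓝 σ) := by
  rcases eq_or_ne σ ∞ with rfl | hσt
  · rw [ENNReal.tendsto_ofReal_nhds_top] at hσ ⊢
    refine tendsto_atTop_mono' l ?_ (tendsto_atTop_add_const_right l (-(1 / 2))
      (hσ.const_mul_atTop (by norm_num : (0 : ℝ) < 1 / 2)))
    filter_upwards [h (1 / 2) (by norm_num)] with i hi
    linarith [(abs_le.1 hi).2]
  · have hvr : Tendsto v l (𝓝 σ.toReal) := by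
      refine ((ENNReal.tendsto_toReal hσt).comp hσ).congr' ?_
      filter_upwards [hv] with i hi
      exact ENNReal.toReal_ofReal hi
    have hdiff : Tendsto (fun i => v i - w i) l (𝓝 0) := by
      rw [Metric.tendsto_nhds]
      intro ε hε
      have hs : 0 < σ.toReal + 2 := by positivity
      filter_upwards [h (ε / (2 * (σ.toReal + 2))) (by positivity), hv,
        hvr.eventually (Iio_mem_nhds (lt_add_one σ.toReal))] with i hi hvi hlt
      rw [Real.dist_eq, sub_zero]
      have hlt' : v i < σ.toReal + 1 := hlt
      calc |v i - w i| ≤ ε / (2 * (σ.toReal + 2)) * (v i + 1) := hi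
        _ ≤ ε / (2 * (σ.toReal + 2)) * (σ.toReal + 2) :=
            mul_le_mul_of_nonneg_left (by linarith) (by positivity)
        _ = ε / 2 := by field_simp
        _ < ε := half_lt_self hε
    have hwr : Tendsto w l (𝓝 σ.toReal) := by simpa using hvr.sub hdiff
    rw [← ENNReal.ofReal_toReal hσt]
    exact (ENNReal.continuous_ofReal.tendsto _).comp hwr

/-- Two nonnegative functions whose difference is negligible compared with one of them have the same
limits in `[0, ∞]`. -/
theorem tendsto_ofReal_iff_of_eventually_abs_sub_le {ι : Type*} {l : Filter ι} {v w : ι → ℝ}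
    (hv : ∀ᶠ i in l, 0 ≤ v i) (hw : ∀ᶠ i in l, 0 ≤ w i)
    (h : ∀ δ : ℝ, 0 < δ → ∀ᶠ i in l, |v i - w i| ≤ δ * (v i + 1)) (σ : ℝ≥0∞) :
    Tendsto (fun i => ENNReal.ofReal (v i)) l (𝓝 σ) ↔
      Tendsto (fun i => ENNReal.ofReal (w i)) l (𝓝 σ) := by
  refine ⟨tendsto_ofReal_of_eventually_abs_sub_le hv h,
    tendsto_ofReal_of_eventually_abs_sub_le hw fun δ hδ => ?_⟩
  filter_upwards [h (min (1 / 2) (δ / 2)) (by positivity), hv, hw] with i hi hvi hwi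
  have h1 : |v i - w i| ≤ 1 / 2 * (v i + 1) :=
    hi.trans (mul_le_mul_of_nonneg_right (min_le_left _ _) (by linarith))
  have h2 : |v i - w i| ≤ δ / 2 * (v i + 1) :=
    hi.trans (mul_le_mul_of_nonneg_right (min_le_right _ _) (by linarith))
  have h3 : v i + 1 ≤ 2 * (w i + 1) := by linarith [(abs_le.1 h1).2]
  rw [abs_sub_comm]
  calc |v i - w i| ≤ δ / 2 * (v i + 1) := h2
    _ ≤ δ / 2 * (2 * (w i + 1)) := by gcongr
    _ = δ * (w i + 1) := by ring

theorem normalizedVariance_nonneg {d : ℕ} {Ω : Type*} [MeasurableSpace Ω] (P : Measure Ω)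
    (Ψ : Ω → Measure (E d)) (W : Set (E d)) (r : ℝ) : 0 ≤ normalizedVariance P Ψ W r :=
  mul_nonneg (by positivity) (variance_nonneg _ _)

variable {d : ℕ} {Ω : Type*} [MeasurableSpace Ω] [AddAction (E d) Ω] [MeasurableVAdd₂ (E d) Ω]
  {P : Measure Ω} [IsProbabilityMeasure P] [VAddInvariantMeasure (E d) Ω P] {Φ : Kernel Ω (E d)}

/-- The reduced second moment measure is translation bounded, and so it integrates Gaussians. -/
theorem integrable_exp_neg_sq_norm (hlf : ∀ ω, IsLocallyFiniteMeasure (Φ ω))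
    (hΦ : InvariantMeasure Φ) (hsq : LocallySquareIntegrable P Φ) :
    Integrable (fun y => Real.exp (-‖y‖ ^ 2)) (reducedSecondMoment P Φ) := by
  have := sigmaFinite_reducedSecondMoment hlf hsq
  set α := reducedSecondMoment P Φ with hα
  set B : Set (E d) := Metric.ball 0 2 with hBdef
  have hB : MeasurableSet B := Metric.isOpen_ball.measurableSet
  have hc := measurable_covariogram hB
  set V : ℝ≥0∞ := volume (Metric.ball (0 : E d) 1) with hV
  have hV0 : V ≠ 0 := (Metric.measure_ball_pos _ _ one_pos).ne'
  have hVt : V ≠ ∞ := Metric.isBounded_ball.measure_lt_top.ne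
  have hgauss : Integrable fun z : E d => Real.exp (-(1 / 2) * ‖z‖ ^ 2) :=
    integrable_exp_neg_mul_sq_norm (by norm_num)
  -- The Gaussian is bounded by a convolution of a wider Gaussian with a covariogram.
  have hle : ∀ y : E d, V * V * ENNReal.ofReal (Real.exp (-‖y‖ ^ 2)) ≤
      ∫⁻ z, ENNReal.ofReal (Real.exp 1 * Real.exp (-(1 / 2) * ‖z‖ ^ 2)) * covariogram B (y + z) := by
    intro y
    have hball : volume (Metric.ball (-y) 1) = V := by
      rw [hV, Measure.addHaar_ball_center]
    calc V * V * ENNReal.ofReal (Real.exp (-‖y‖ ^ 2))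
        = ∫⁻ _ in Metric.ball (-y) 1, ENNReal.ofReal (Real.exp (-‖y‖ ^ 2)) * V := by
          rw [setLIntegral_const, hball]
          ring
      _ ≤ ∫⁻ z in Metric.ball (-y) 1,
            ENNReal.ofReal (Real.exp 1 * Real.exp (-(1 / 2) * ‖z‖ ^ 2)) * covariogram B (y + z) := by
          refine setLIntegral_mono' measurableSet_ball fun z hz => ?_
          have hyz : ‖y + z‖ < 1 := by
            rw [mem_ball_iff_norm, sub_neg_eq_add, add_comm] at hz
            exact hz
          refine mul_le_mul' (ENNReal.ofReal_le_ofReal ?_) (measure_mono fun x hx => ?_)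
          · rw [← Real.exp_add]
            refine Real.exp_le_exp.2 ?_
            have h1 : ‖z‖ ≤ 1 + ‖y‖ := by
              calc ‖z‖ = ‖(y + z) - y‖ := by rw [add_sub_cancel_left]
                _ ≤ ‖y + z‖ + ‖y‖ := norm_sub_le _ _
                _ ≤ 1 + ‖y‖ := by linarith
            nlinarith [norm_nonneg z, norm_nonneg y, sq_nonneg (‖y‖ - 1)]
          · rw [mem_ball_zero_iff] at hx
            simp only [hBdef, Set.mem_inter_iff, Set.mem_preimage, mem_ball_zero_iff]
            exact ⟨by linarith, by linarith [norm_add_le x (y + z)]⟩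
      _ ≤ _ := setLIntegral_le_lintegral _ _
  refine (lintegral_ofReal_ne_top_iff_integrable (by fun_prop)
    (Eventually.of_forall fun y => (Real.exp_pos _).le)).1 fun htop => ?_
  have h1 : V * V * ∫⁻ y, ENNReal.ofReal (Real.exp (-‖y‖ ^ 2)) ∂α ≤
      (∫⁻ z : E d, ENNReal.ofReal (Real.exp 1 * Real.exp (-(1 / 2) * ‖z‖ ^ 2)))
        * ∫⁻ ω, Φ ω B ^ 2 ∂P := by
    rw [← lintegral_const_mul _ (by fun_prop)]
    refine (lintegral_mono hle).trans ?_
    rw [lintegral_lintegral_swap (by fun_prop), ← lintegral_mul_const _ (by fun_prop)]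
    refine lintegral_mono fun z => ?_
    rw [lintegral_const_mul _ (by fun_prop)]
    exact mul_le_mul_right (lintegral_covariogram_le hlf hΦ hsq hB z) _
  rw [htop, ENNReal.mul_top (mul_ne_zero hV0 hV0)] at h1
  refine (ENNReal.mul_lt_top ?_ (hsq B hB Metric.isBounded_ball)).not_ge h1
  rw [← ofReal_integral_eq_lintegral_ofReal (hgauss.const_mul _)
    (Eventually.of_forall fun z => by positivity)]
  exact ENNReal.ofReal_lt_top

theorem spectralApprox_nonneg (hlf : ∀ ω, IsLocallyFiniteMeasure (Φ ω))
    (hΦ : InvariantMeasure Φ) (hsq : LocallySquareIntegrable P Φ) {W : Set (E d)}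
    (hW : IsWindow W) {N : ℝ} (hN : 0 < N) (k : E d) :
    0 ≤ spectralApprox (reducedSecondMoment P Φ) (intensity P Φ ^ 2 • volume) W N k :=
  sub_nonneg.2 (integral_windowCorr_mul_cos_le hlf hΦ hsq hW hN k)

/-- The mixing condition, with the mean relative displacement replaced by some probability measure
so as to cover random measures of intensity zero. -/
theorem exists_isProbabilityMeasure_mixing {K : Kernel (Ω × E d) (E d)} [IsMarkovKernel K]
    {Q : Kernel (E d) Ω} (hlf : ∀ ω, IsLocallyFiniteMeasure (Φ ω))
    (hΦ : InvariantMeasure Φ) (hsq : LocallySquareIntegrable P Φ) (hK : InvariantKernel K)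
    (hQ : IsTwoPointPalm P Φ Q)
    (hκ : ∫⁻ y, mixingCoeff P Φ K Q y ∂(reducedSecondMoment P Φ) < ∞) :
    ∃ μ : Measure (E d), IsProbabilityMeasure μ ∧
      ∫⁻ y, tvNormSub (displacementPair K Q y) (μ.prod μ) ∂(reducedSecondMoment P Φ) < ∞ := by
  have := hQ.isMarkovKernel
  by_cases h0 : intensity P Φ = 0
  · -- Without points, the mean relative displacement is the zero measure, and any law will do.
    refine ⟨Measure.dirac 0, inferInstance, ?_⟩
    rw [reducedSecondMoment_eq_zero hlf hΦ hsq h0, lintegral_zero_measure]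
    exact ENNReal.zero_lt_top
  · refine ⟨meanRelKernel P Φ K, isProbabilityMeasure_meanRelKernel hlf hsq hK h0, ?_⟩
    simpa only [mixingCoeff, displacementPair_apply hK] using hκ

end Asymptotics

end InvariantTransport

end

open InvariantTransport in
theorem theorem3p5 {d : ℕ} {Ω : Type*} [MeasurableSpace Ω] [StandardBorelSpace Ω]
    [AddAction (E d) Ω] [MeasurableVAdd₂ (E d) Ω]
    (P : Measure Ω) [IsProbabilityMeasure P] [VAddInvariantMeasure (E d) Ω P]
    (Φ : Kernel Ω (E d)) (hΦ_locallyFinite : ∀ ω, IsLocallyFiniteMeasure (Φ ω))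
    (hΦ_invariant : InvariantMeasure Φ) (hΦ_sq : LocallySquareIntegrable P Φ)
    (K : Kernel (Ω × E d) (E d)) [IsMarkovKernel K] (hK_invariant : InvariantKernel K)
    (Q : Kernel (E d) Ω) (hQ : IsTwoPointPalm P Φ Q)
    (hκ : ∫⁻ y, mixingCoeff P Φ K Q y ∂(reducedSecondMoment P Φ) < ∞) :
    LocallySquareIntegrable P (destination K Φ) ∧
    (∀ W : Set (E d), IsWindow W →
      Hyperuniform P Φ W → Hyperuniform P (destination K Φ) W) ∧
    (∀ W : Set (E d), IsWindow W →
      (FourierSmooth W ∨ covarianceTotalVariation P Φ < ∞) →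
      ∀ σ : ℝ≥0∞,
        HasAsymptoticVariance P Φ W σ ↔ HasAsymptoticVariance P (destination K Φ) W σ) ∧
    (covarianceTotalVariation P Φ < ∞ → ∀ W : Set (E d), IsWindow W →
      ∃ σ : ℝ≥0∞, σ < ∞ ∧
        HasAsymptoticVariance P Φ W σ ∧ HasAsymptoticVariance P (destination K Φ) W σ) := by
  obtain ⟨μ, _, hπ⟩ := exists_isProbabilityMeasure_mixing hΦ_locallyFinite hΦ_invariant hΦ_sq
    hK_invariant hQ hκ
  have := hQ.isMarkovKernel
  have := sigmaFinite_reducedSecondMoment hΦ_locallyFinite hΦ_sq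
  have hdest := locallySquareIntegrable_destination hΦ_locallyFinite hΦ_invariant hΦ_sq
    hK_invariant hQ hπ
  set γ := intensity P Φ
  set α := reducedSecondMoment P Φ
  set s : Set (E d) → ℝ → ℝ := decoupledVariance α γ.toReal (μ.prod μ)
  have hfin : ∀ W : Set (E d), IsWindow W → ∀ (π : Measure (E d × E d)) [IsProbabilityMeasure π]
      (r : ℝ), 0 < r → ∫⁻ y, ∫⁻ p, covariogram (r • W) (y + (p.1 - p.2)) ∂π ∂α < ∞ :=
    fun W hW π _ r hr =>
      (lintegral_lintegral_covariogram_le hΦ_locallyFinite hΦ_invariant hΦ_sq π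
        (hW.smul hr).measurableSet).trans_lt
        (hΦ_sq _ (hW.smul hr).measurableSet (hW.smul hr).isBounded)
  -- Up to a vanishing error, the displacements may be taken independent of `Φ`.
  have hdec : ∀ W, IsWindow W →
      Tendsto (fun r => normalizedVariance P (destination K Φ) W r - s W r) atTop (𝓝 0) := by
    intro W hW
    refine squeeze_zero_norm' ?_
      ((ENNReal.tendsto_toReal ENNReal.zero_ne_top).comp (tendsto_decouplingError hW hπ))
    filter_upwards [eventually_gt_atTop 0] with r hr
    exact abs_normalizedVariance_destination_sub_le hΦ_locallyFinite hΦ_invariant hΦ_sq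
      hK_invariant hQ hπ hW hr
  have hle : ∀ W, IsWindow W → ∀ᶠ r in atTop, s W r ≤ normalizedVariance P Φ W r := by
    intro W hW
    filter_upwards [eventually_gt_atTop 0] with r hr
    exact decoupledVariance_le hΦ_locallyFinite hΦ_invariant hΦ_sq hW (μ.prod μ) hr
  have hdirac : ∀ W, IsWindow W → decoupledVariance α γ.toReal (Measure.dirac 0) W
      =ᶠ[atTop] normalizedVariance P Φ W := by
    intro W hW
    filter_upwards [eventually_gt_atTop 0] with r hr
    exact (normalizedVariance_eq_decoupledVariance hΦ_locallyFinite hΦ_invariant hΦ_sq hW hr).symm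
  have hfinite : covarianceTotalVariation P Φ < ∞ → ∀ W, IsWindow W →
      ∃ L : ℝ, HasAsymptoticVariance P Φ W (ENNReal.ofReal L) ∧
        HasAsymptoticVariance P (destination K Φ) W (ENNReal.ofReal L) := by
    intro htv W hW
    obtain ⟨L, hL⟩ := exists_tendsto_decoupledVariance hW (intensity_ne_top hΦ_sq)
      (fun n => reducedSecondMoment_ball_lt_top P Φ hΦ_locallyFinite hΦ_sq n) htv
    have hw : Tendsto (normalizedVariance P (destination K Φ) W) atTop (𝓝 L) := by
      have h := (hdec W hW).add (hL (μ.prod μ) (hfin W hW _))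
      rw [zero_add] at h
      exact h.congr fun r => sub_add_cancel _ _
    exact ⟨L, (ENNReal.continuous_ofReal.tendsto L).comp
        ((hL (Measure.dirac 0) (hfin W hW _)).congr' (hdirac W hW)),
      (ENNReal.continuous_ofReal.tendsto L).comp hw⟩
  refine ⟨hdest, fun W hW hhyp => ⟨hdest, ?_⟩, fun W hW hor σ => ?_, fun htv W hW => ?_⟩
  · have h := (hdec W hW).add hhyp.2
    rw [add_zero] at h
    refine squeeze_zero' (Eventually.of_forall fun r => normalizedVariance_nonneg P _ W r) ?_ h
    filter_upwards [hle W hW] with r hr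
    linarith
  · rcases hor with hF | htv
    · refine tendsto_ofReal_iff_of_eventually_abs_sub_le
        (Eventually.of_forall fun r => normalizedVariance_nonneg P _ W r)
        (Eventually.of_forall fun r => normalizedVariance_nonneg P _ W r) (fun δ hδ => ?_) σ
      have hsub := eventually_decoupledVariance_sub_le (μ := μ) hW hF (intensity_ne_top hΦ_sq)
        (hfin W hW) (integrable_exp_neg_sq_norm hΦ_locallyFinite hΦ_invariant hΦ_sq)
        (fun N hN k => spectralApprox_nonneg hΦ_locallyFinite hΦ_invariant hΦ_sq hW hN k)
        (half_pos hδ)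
      filter_upwards [hsub, hdirac W hW, hle W hW,
        Metric.tendsto_nhds.1 (hdec W hW) (δ / 2) (half_pos hδ)] with r h1 h2 h3 h4
      rw [h2] at h1
      rw [Real.dist_eq, sub_zero] at h4
      obtain ⟨h5, h6⟩ := abs_lt.1 h4
      have h7 : 0 ≤ δ * normalizedVariance P Φ W r :=
        mul_nonneg hδ.le (normalizedVariance_nonneg P _ W r)
      change normalizedVariance P Φ W r - s W r ≤ _ at h1
      rw [abs_le]
      constructor <;> linarith
    · obtain ⟨L, h1, h2⟩ := hfinite htv W hW
      constructor <;> intro h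
      · rwa [tendsto_nhds_unique h h1]
      · rwa [tendsto_nhds_unique h h2]
  · obtain ⟨L, h⟩ := hfinite htv W hW
    exact ⟨ENNReal.ofReal L, ENNReal.ofReal_lt_top, h⟩
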